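/- **Theorem (Multiclass Margin Bound).** Let $\mu$ be a probability measure on $\mathcal X\times\{1,\dots,C\}$, with class proportions $p(i)=\mu(y=i)$ and class-conditional laws $P_i$ (the law of $x$ given $y=i$). Let $S=\{(x_k,y_k)\}_{k=1}^N$ be drawn i.i.d. from $\mu$, let $S_i$ be the (multi)set of sample points $x_k$ with $y_k=i$, and $N_i=|S_i|$. Let $\mathcal H$ be a set of classifiers $(M,f(\cdot;w))$, with $M=(M_1,\dots,M_C)$, $M_c\in\mathbb R^d$, and measurable feature extractors $f(\cdot;w):\mathcal X\to\mathbb R^d$; the logits are $\langle M_c,f(x;w)\rangle$. Let $$\mathcal F=\{(M_i-M_j)^{T}f(\cdot;w)\;:\; i\neq j,\ (M,f(\cdot;w))\in\mathcal H\}$$ and assume that $\mathcal F$ is pointwise measurable (it has a countable subset $\mathcal F_0$ such that every member of $\mathcal F$ is the pointwise limit of a sequence in $\mathcal F_0$). Let $K$ be such that, for every $i$ and $P_i$-almost every $x$, $$|(M_i-M_j)^{T}f(x;w)|\le K\quad\text{for all }j\ne i\text{ and all }(M,f(\cdot;w))\in\mathcal H .$$ Let $\mathfrak R_{N_i}(\mathcal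 F)=\mathbb E\,\sup_{g\in\mathcal F}\bigl|\tfrac{2}{N_i}\sum_{k=1}^{N_i}\sigma_k g(x_k)\bigr|$ be the Rademacher complexity of $\mathcal F$ for $N_i$ i.i.d. points $x_k$ of law $P_i$ and independent uniform signs $\sigma_k$. For margins $\gamma_{ij}>0$ ($i\ne j$) and $a>0$ put $$B_a=\sum_{i=1}^{C}p(i)\sum_{j\ne i}\left(a\,\frac{\mathfrak R_{N_i}(\mathcal F)}{\gamma_{ij}}+\sqrt{\frac{\log\log_2\frac{4K}{\gamma_{ij}}}{N_i}}+\sum_{x\in S_i}\frac{\mathbb I\bigl((M_i-M_j)^{T}f(x;w)\le\gamma_{ij}\bigr)}{N_i}+\sqrt{\frac{\log(C(C-1)/\delta)}{2N_i}}\right),$$ where $\log\log_2(4K/\gamma_{ij})$ is read as $0$ if $4K/\gamma_{ij}<2$, and $B_a=+\infty$ if $N_i=0$ for some $i$ with $p(i)>0$. Let $\delta>0$. Then: 1. for any margins $\{\gamma_{ij}\}_{i\ne j}$, $\gamma_{ij}>0$, with probability at least $1-\delta$ over $S$, every classifier $(M,f(\cdot;w))\in\mathcal H$ satisfies $$\mathbb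 P_{x,y}\Bigl(\arg\max_c\,\langle M_c,f(x;w)\rangle\ne y\Bigr)\le B_1;$$ 2. with probability at least $1-\delta$ over $S$, every classifier in $\mathcal H$ and all margins $\{\gamma_{ij}\}_{i\ne j}$, $\gamma_{ij}>0$, simultaneously satisfy the same inequality with $B_2$ in place of $B_1$. Here "$\arg\max_c\ne y$" means that $y$ is not the unique maximiser, i.e. ties count as errors. -/

import Mathlib

open MeasureTheory ProbabilityTheory
open scoped ENNReal

noncomputable section

namespace MulticlassMargin

/-- A linear layer `M = (M_1, …, M_C)` of vectors of `ℝ^d`, with a feature-extractor parameter `w`. -/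
abbrev Classifier (C d : ℕ) (W : Type*) := (Fin C → EuclideanSpace ℝ (Fin d)) × W

section General

variable {X W : Type*} {C d : ℕ}

/-- The `c`-th logit `⟨M_c, f(x; w)⟩`. -/
def logit (f : W → X → EuclideanSpace ℝ (Fin d)) (h : Classifier C d W) (c : Fin C) (x : X) : ℝ :=
  inner ℝ (h.1 c) (f h.2 x)

/-- The margin `(M_i - M_j)ᵀ f(x; w)` between the classes `i` and `j`. -/
def margin (f : W → X → EuclideanSpace ℝ (Fin d)) (h : Classifier C d W) (i j : Fin C) (x : X) :
    ℝ :=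
  inner ℝ (h.1 i - h.1 j) (f h.2 x)

/-- The function space of the margins of all classifiers in `H`, over all pairs `i ≠ j`. -/
def marginClass (f : W → X → EuclideanSpace ℝ (Fin d)) (H : Set (Classifier C d W)) :
    Set (X → ℝ) :=
  {g | ∃ h ∈ H, ∃ i j : Fin C, i ≠ j ∧ g = margin f h i j}

/-- A pointwise measurable (pointwise separable) class of functions: some countable subclass
contains, for each member of the class, a sequence converging to it at every point. -/
def IsPointwiseMeasurable (F : Set (X → ℝ)) : Prop :=
  ∃ F₀ ⊆ F, F₀.Countable ∧ ∀ g ∈ F, ∃ u : ℕ → X → ℝ, (∀ m, u m ∈ F₀) ∧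
    ∀ x, Filter.Tendsto (fun m => u m x) Filter.atTop (nhds (g x))

end General

section Sample

variable {X W : Type*} [MeasurableSpace X] {C d N : ℕ}

/-- The Rademacher complexity `E_x E_σ sup_{g ∈ F} |(2/n) ∑ₖ σₖ g(xₖ)|`, where `x₁, …, xₙ` are
i.i.d. with law `P` and `σ` is uniform on `{-1, 1}ⁿ`, with values in `[0, ∞]`. -/
def rademacher (P : Measure X) (n : ℕ) (F : Set (X → ℝ)) : ℝ≥0∞ :=
  ∫⁻ x : Fin n → X,
    (∑ σ : Fin n → ℤˣ,
      ⨆ g ∈ F, ENNReal.ofReal |(2 / (n : ℝ)) * ∑ k, ((σ k : ℤ) : ℝ) * g (x k)|) / 2 ^ n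
    ∂(Measure.pi fun _ => P)

/-- The proportion `p(i)` of the class `i`. -/
def classProb (μ : Measure (X × Fin C)) (i : Fin C) : ℝ :=
  μ.real {z | z.2 = i}

/-- The law of `x` given `y = i`. -/
def classCond (μ : Measure (X × Fin C)) (i : Fin C) : Measure X :=
  (μ[|{z | z.2 = i}]).map Prod.fst

/-- The probability that the true label is not the only maximiser of the logits. Ties count as
errors, so this dominates the error probability for every rule that breaks ties. -/
def misclassProb (μ : Measure (X × Fin C)) (f : W → X → EuclideanSpace ℝ (Fin d))
    (h : Classifier C d W) : ℝ :=
  μ.real {z | ∃ c, c ≠ z.2 ∧ logit f h z.2 z.1 ≤ logit f h c z.1}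

/-- The number `N_i` of sample points of class `i`. -/
def classCount (S : Fin N → X × Fin C) (i : Fin C) : ℕ :=
  (Finset.univ.filter fun k => (S k).2 = i).card

/-- `∑ᵢ p(i) ∑_{j ≠ i} R_{Nᵢ}(F) / γᵢⱼ`, with the complexity taken under the law of the class. -/
def rademacherTerm (μ : Measure (X × Fin C)) (F : Set (X → ℝ)) (γ : Fin C → Fin C → ℝ)
    (S : Fin N → X × Fin C) : ℝ :=
  ∑ i, classProb μ i * ∑ j ∈ Finset.univ.erase i,
    (rademacher (classCond μ i) (classCount S i) F).toReal / γ i j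

/-- `∑ᵢ p(i) ∑_{j ≠ i} √(log log₂ (4K / γᵢⱼ) / Nᵢ)`. The iterated logarithm is read as `0` when
`4K / γᵢⱼ < 2`, where it would be negative or undefined. -/
def logLogTerm (μ : Measure (X × Fin C)) (K : ℝ) (γ : Fin C → Fin C → ℝ)
    (S : Fin N → X × Fin C) : ℝ :=
  ∑ i, classProb μ i * ∑ j ∈ Finset.univ.erase i,
    √(Real.log (max 1 (Real.logb 2 (4 * K / γ i j))) / (classCount S i : ℝ))

/-- `∑ᵢ p(i) ∑_{j ≠ i} √(log (C (C - 1) / δ) / (2 Nᵢ))`. -/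
def confidenceTerm (μ : Measure (X × Fin C)) (δ : ℝ) (S : Fin N → X × Fin C) : ℝ :=
  ∑ i, classProb μ i * ∑ _j ∈ Finset.univ.erase i,
    √(Real.log ((C : ℝ) * ((C : ℝ) - 1) / δ) / (2 * (classCount S i : ℝ)))

/-- `∑ᵢ p(i) ∑_{j ≠ i} (1 / Nᵢ) #{x ∈ Sᵢ : (M_i - M_j)ᵀ f(x; w) ≤ γᵢⱼ}`, with multiplicity. -/
def empiricalRisk (μ : Measure (X × Fin C)) (f : W → X → EuclideanSpace ℝ (Fin d))
    (h : Classifier C d W) (γ : Fin C → Fin C → ℝ) (S : Fin N → X × Fin C) : ℝ :=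
  ∑ i, classProb μ i * ∑ j ∈ Finset.univ.erase i,
    ∑ k ∈ Finset.univ.filter (fun k => (S k).2 = i),
      (if margin f h i j (S k).1 ≤ γ i j then (1 : ℝ) else 0) / (classCount S i : ℝ)

/-- Every class of positive probability has a sample point, so that the bounds, which divide by
the numbers `N_i`, are finite. -/
def Represented (μ : Measure (X × Fin C)) (S : Fin N → X × Fin C) : Prop :=
  ∀ i, 0 < classProb μ i → 0 < classCount S i

end Sample

end MulticlassMargin

end

namespace MulticlassMargin

/-! ### The bounded differences inequality -/

section BoundedDifferences

variable {X : Type*} [MeasurableSpace X]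

/-! A point of class `i` is misclassified exactly when one of its margins against some `j ≠ i` is
nonpositive. Splitting by class and by `j` bounds the error by a sum, weighted by `p(i)`, of the
probabilities under `P_i` that one margin is nonpositive. Each is at most a mean ramp loss, since
the ramp of width `γ` is `1` on nonpositive reals (`misclassProb_le`). The ramp is also at most the
indicator of `t ≤ γ`, so its empirical mean is controlled by the empirical margin risk.

For one pair and `n` i.i.d. points of law `P_i`, the largest gap between true and empirical ramp
risk changes by at most `1/n` with one point, so McDiarmid's inequality concentrates it around its
mean (`measureReal_ge_le_of_bounded_differences`). Symmetrization (`integral_deviation_le`) and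
contraction by the Lipschitz constant `1/γ` (`sum_signs_iSup_lipschitz_le`) bound that mean by the
Rademacher complexity over `γ`. These suprema run over finite families; monotone unions give
countable classes, and pointwise limits the rest.

The number `N_i` is random, but given the labels the points of class `i` are i.i.d. of law `P_i`
(`measure_labelEvent_inter`). A failure bound uniform in `n` thus survives averaging over the
labels. A union bound over the `C(C-1)` pairs gives the first statement.

For all margins at once, the union also runs over the dyadic widths `K/2^(m+1)`, with failure
weights `1/(m+2)^2` of total mass at most `1`. These weights cost the iterated logarithm; rounding
`γ` down to a dyadic width costs the factor `2`. If `γ ≥ K`, almost surely every sample point counts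
in the empirical risk and the bound is trivial. -/

lemma integrable_of_abs_le {Ω : Type*} [MeasurableSpace Ω] {P : Measure Ω} [IsFiniteMeasure P]
    {F : Ω → ℝ} (hF : Measurable F) {B : ℝ} (hB : ∀ x, |F x| ≤ B) : Integrable F P :=
  Integrable.of_bound hF.aestronglyMeasurable B (Filter.Eventually.of_forall hB)

lemma integrable_exp_of_abs_le {Ω : Type*} [MeasurableSpace Ω] {P : Measure Ω} [IsFiniteMeasure P]
    {F : Ω → ℝ} (hF : Measurable F) {B : ℝ} (hB : ∀ x, |F x| ≤ B) :
    Integrable (fun x => Real.exp (F x)) P := by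
  refine integrable_of_abs_le (by fun_prop) (B := Real.exp B) fun x => ?_
  rw [abs_of_pos (Real.exp_pos _)]
  exact Real.exp_le_exp.2 ((le_abs_self _).trans (hB x))

lemma abs_integral_le_of_abs_le {Ω : Type*} [MeasurableSpace Ω] {P : Measure Ω}
    [IsProbabilityMeasure P] {F : Ω → ℝ} {B : ℝ} (hB : ∀ x, |F x| ≤ B) : |∫ x, F x ∂P| ≤ B := by
  have := norm_integral_le_of_norm_le_const (μ := P) (f := F) (C := B)
    (Filter.Eventually.of_forall hB)
  simpa using this

/-- Hoeffding's lemma for a bounded function of oscillation at most `c`. -/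
lemma integral_exp_le_of_oscillation {P : Measure X} [IsProbabilityMeasure P] {c : ℝ} (hc : 0 ≤ c)
    (s : ℝ) {F : X → ℝ} (hF : Measurable F) {B : ℝ} (hB : ∀ x, |F x| ≤ B)
    (hd : ∀ x y, F x - F y ≤ c) :
    ∫ x, Real.exp (s * F x) ∂P ≤ Real.exp (s * ∫ x, F x ∂P + c ^ 2 * s ^ 2 / 8) := by
  have : Nonempty X := nonempty_of_isProbabilityMeasure P
  have hbdd : BddBelow (Set.range F) := ⟨-B, by rintro _ ⟨x, rfl⟩; exact (abs_le.1 (hB x)).1⟩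
  have hmem : ∀ x, F x ∈ Set.Icc (⨅ y, F y) ((⨅ y, F y) + c) := fun x =>
    ⟨ciInf_le hbdd x, by
      have : F x - c ≤ ⨅ y, F y := le_ciInf fun y => by linarith [hd x y]
      linarith⟩
  have h := (hasSubgaussianMGF_of_mem_Icc (μ := P) hF.aemeasurable
    (Filter.Eventually.of_forall hmem)).mgf_le s
  have h2 : ∫ x, Real.exp (s * F x) ∂P
      = Real.exp (s * ∫ x, F x ∂P) * mgf (fun x => F x - ∫ y, F y ∂P) P s := by
    rw [mgf, ← integral_const_mul]
    refine integral_congr_ae (Filter.Eventually.of_forall fun x => ?_)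
    simp only
    rw [← Real.exp_add]
    congr 1; ring
  rw [h2, Real.exp_add]
  refine mul_le_mul_of_nonneg_left (h.trans (le_of_eq ?_)) (Real.exp_pos _).le
  congr 1
  simp [abs_of_nonneg hc]
  ring

/-- Induction on `n`, integrating out the first coordinate. With the others fixed, Hoeffding's lemma
costs one factor `exp (c² s² / 8)`; the averaged function of the other coordinates inherits the
bounded differences. -/
lemma integral_exp_le_of_bounded_differences (P : Measure X) [IsProbabilityMeasure P] {c : ℝ}
    (hc : 0 ≤ c) (s B : ℝ) (n : ℕ) (F : (Fin n → X) → ℝ) (hF : Measurable F)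
    (hB : ∀ x, |F x| ≤ B) (hd : ∀ x y k, (∀ j, j ≠ k → x j = y j) → F x - F y ≤ c) :
    ∫ x, Real.exp (s * F x) ∂(Measure.pi fun _ => P)
      ≤ Real.exp (s * ∫ x, F x ∂(Measure.pi fun _ => P) + n * (c ^ 2 * s ^ 2 / 8)) := by
  induction n with
  | zero =>
    have h : F = fun _ => F default := funext fun x => congrArg F (Subsingleton.elim _ _)
    rw [h]; simp
  | succ n ih =>
    let e := MeasurableEquiv.piFinSuccAbove (fun _ : Fin (n + 1) => X) 0
    have hmp := measurePreserving_piFinSuccAbove (fun _ : Fin (n + 1) => P) 0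
    have hint : ∀ Φ : (Fin (n + 1) → X) → ℝ, ∫ x, Φ x ∂(Measure.pi fun _ => P)
        = ∫ z, Φ (e.symm z) ∂(P.prod (Measure.pi fun _ : Fin n => P)) := fun Φ =>
      (hmp.symm.integral_comp e.symm.measurableEmbedding Φ).symm
    let G : X × (Fin n → X) → ℝ := fun z => F (e.symm z)
    have hG : Measurable G := hF.comp e.symm.measurable
    have hGB : ∀ z, |G z| ≤ B := fun z => hB _
    have e0 : ∀ x y, e.symm (x, y) 0 = x := fun x y => rfl
    have es : ∀ x y (k : Fin n), e.symm (x, y) k.succ = y k := fun x y k => by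
      simp [e, MeasurableEquiv.piFinSuccAbove, Fin.insertNthEquiv]
    let F' : (Fin n → X) → ℝ := fun y => ∫ x, G (x, y) ∂P
    have hF' : Measurable F' :=
      (hG.stronglyMeasurable.integral_prod_left' (μ := P)).measurable
    have hF'B : ∀ y, |F' y| ≤ B := fun y => abs_integral_le_of_abs_le fun x => hGB _
    have hGi : ∀ y, Integrable (fun x => G (x, y)) P := fun y =>
      integrable_of_abs_le (hG.comp measurable_prodMk_right) fun x => hGB _
    have hd' : ∀ x y k, (∀ j, j ≠ k → x j = y j) → F' x - F' y ≤ c := by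
      intro x y k hxy
      rw [← integral_sub (hGi x) (hGi y)]
      refine (integral_mono ((hGi x).sub (hGi y)) (integrable_const c) fun a => ?_).trans
        (by simp)
      refine hd _ _ k.succ fun j hj => ?_
      rcases Fin.eq_zero_or_eq_succ j with rfl | ⟨j, rfl⟩
      · rw [e0, e0]
      · rw [es, es]; exact hxy j fun h => hj (by rw [h])
    have hexp : ∀ z, |s * G z| ≤ |s| * B := fun z => by
      rw [abs_mul]; exact mul_le_mul_of_nonneg_left (hGB z) (abs_nonneg _)
    rw [hint, hint, integral_prod_symm _ (integrable_exp_of_abs_le (hG.const_mul s) hexp),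
      integral_prod_symm _ (integrable_of_abs_le hG hGB)]
    have hstep : ∀ y, ∫ x, Real.exp (s * G (x, y)) ∂P
        ≤ Real.exp (s * F' y) * Real.exp (c ^ 2 * s ^ 2 / 8) := fun y => by
      rw [← Real.exp_add]
      refine integral_exp_le_of_oscillation hc s (hG.comp measurable_prodMk_right)
        (fun x => hGB _) fun x x' => ?_
      refine hd _ _ 0 fun j hj => ?_
      rcases Fin.eq_zero_or_eq_succ j with rfl | ⟨j, rfl⟩
      · exact absurd rfl hj
      · rw [es, es]
    have hexp' : ∀ y, |s * F' y| ≤ |s| * B := fun y => by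
      rw [abs_mul]; exact mul_le_mul_of_nonneg_left (hF'B y) (abs_nonneg _)
    calc ∫ y, ∫ x, Real.exp (s * G (x, y)) ∂P ∂(Measure.pi fun _ : Fin n => P)
        ≤ ∫ y, Real.exp (s * F' y) * Real.exp (c ^ 2 * s ^ 2 / 8)
            ∂(Measure.pi fun _ : Fin n => P) :=
          integral_mono
            (integrable_exp_of_abs_le (hG.const_mul s) hexp).integral_prod_right
            ((integrable_exp_of_abs_le (hF'.const_mul s) hexp').mul_const _) hstep
      _ ≤ Real.exp (s * ∫ y, F' y ∂(Measure.pi fun _ : Fin n => P) + n * (c ^ 2 * s ^ 2 / 8))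
            * Real.exp (c ^ 2 * s ^ 2 / 8) := by
          rw [integral_mul_const]
          exact mul_le_mul_of_nonneg_right (ih F' hF' hF'B hd') (Real.exp_pos _).le
      _ = _ := by
          rw [← Real.exp_add]
          congr 1
          push_cast
          simp only [F', G]
          ring

/-- **McDiarmid's inequality** for functions of `n` i.i.d. variables all of whose differences are
bounded by `1 / n`. -/
theorem measureReal_ge_le_of_bounded_differences (P : Measure X) [IsProbabilityMeasure P]
    {n : ℕ} (hn : 0 < n) (F : (Fin n → X) → ℝ) (hF : Measurable F) {B : ℝ}
    (hB : ∀ x, |F x| ≤ B)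
    (hd : ∀ x y k, (∀ j, j ≠ k → x j = y j) → F x - F y ≤ 1 / (n : ℝ)) {t : ℝ} (ht : 0 ≤ t) :
    (Measure.pi fun _ : Fin n => P).real
      {x | ∫ x, F x ∂(Measure.pi fun _ : Fin n => P) + t ≤ F x}
      ≤ Real.exp (-2 * n * t ^ 2) := by
  have hn' : (0 : ℝ) < n := by exact_mod_cast hn
  set Q := Measure.pi fun _ : Fin n => P
  set m := ∫ x, F x ∂Q
  -- With `c = 1/n` the exponent `n c² s² / 8` equals `s² / (8n)`, which is variance proxy `1/(4n)`.
  have hsub : HasSubgaussianMGF (fun x => F x - m) (1 / (4 * (n : NNReal))) Q := by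
    constructor
    · intro s
      refine integrable_exp_of_abs_le ((hF.sub_const m).const_mul s)
        (B := |s| * (B + |m|)) fun x => ?_
      rw [abs_mul]
      exact mul_le_mul_of_nonneg_left ((abs_sub _ _).trans (by linarith [hB x])) (abs_nonneg _)
    · intro s
      have h := integral_exp_le_of_bounded_differences P (c := 1 / n) (by positivity) s B n F hF
        hB hd
      have h2 : mgf (fun x => F x - m) Q s
          = Real.exp (-(s * m)) * ∫ x, Real.exp (s * F x) ∂Q := by
        rw [mgf, ← integral_const_mul]
        refine integral_congr_ae (Filter.Eventually.of_forall fun x => ?_)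
        simp only
        rw [← Real.exp_add]
        congr 1; ring
      rw [h2]
      refine (mul_le_mul_of_nonneg_left h (Real.exp_pos _).le).trans (le_of_eq ?_)
      rw [← Real.exp_add]
      congr 1
      push_cast
      simp only [m, Q]
      field_simp
      ring
  have h := hsub.measure_ge_le ht
  have hset : {x | m + t ≤ F x} = {x | t ≤ F x - m} := by
    ext x; simp only [Set.mem_ofPred_eq]; constructor <;> intro h <;> linarith
  rw [hset]
  refine h.trans (le_of_eq ?_)
  congr 1
  push_cast
  field_simp
  ring

end BoundedDifferences

/-! ### The contraction principle -/

section Contraction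

variable {ι : Type*} [Finite ι]

lemma le_iSup_of_finite (a : ι → ℝ) (i : ι) : a i ≤ ⨆ j, a j :=
  le_ciSup (Set.finite_range a).bddAbove i

/-- The contraction of a single coordinate. For indices `i`, `j` of the two suprema, the right side
is symmetric in `i` and `j`, so giving the plus sign to the larger of `a i`, `a j` removes the
absolute value in the Lipschitz bound. -/
lemma iSup_add_iSup_sub_le [Nonempty ι] {φ : ℝ → ℝ} {L : ℝ} (hφ : ∀ u v, |φ u - φ v| ≤ L * |u - v|)
    (b a : ι → ℝ) :
    (⨆ i, (b i + φ (a i))) + (⨆ i, (b i - φ (a i)))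
      ≤ (⨆ i, (b i + L * a i)) + ⨆ i, (b i - L * a i) := by
  have key : ∀ i j, (b i + φ (a i)) + (b j - φ (a j))
      ≤ (⨆ i, (b i + L * a i)) + ⨆ i, (b i - L * a i) := by
    intro i j
    have h := (le_abs_self _).trans (hφ (a i) (a j))
    have h1 := le_iSup_of_finite (fun i => b i + L * a i)
    have h2 := le_iSup_of_finite (fun i => b i - L * a i)
    rcases le_total (a j) (a i) with hij | hij
    · rw [abs_of_nonneg (sub_nonneg.2 hij)] at h
      have := h1 i; have := h2 j
      linarith
    · rw [abs_of_nonpos (sub_nonpos.2 hij)] at h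
      have := h1 j; have := h2 i
      linarith
  have : ∀ i, (b i + φ (a i)) ≤ (⨆ i, (b i + L * a i)) + (⨆ i, (b i - L * a i))
      - ⨆ i, (b i - φ (a i)) := by
    intro i
    have : (⨆ j, (b j - φ (a j))) ≤ (⨆ i, (b i + L * a i)) + (⨆ i, (b i - L * a i))
      - (b i + φ (a i)) := ciSup_le fun j => by linarith [key i j]
    linarith
  linarith [ciSup_le this]

lemma sum_signs_succ {n : ℕ} (Φ : (Fin (n + 1) → ℤˣ) → ℝ) :
    ∑ σ, Φ σ = ∑ σ : Fin n → ℤˣ, (Φ (Fin.cons 1 σ) + Φ (Fin.cons (-1) σ)) := by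
  rw [← (Fin.consEquiv fun _ : Fin (n + 1) => ℤˣ).sum_comp, Fintype.sum_prod_type,
    Finset.sum_comm]
  refine Finset.sum_congr rfl fun σ _ => ?_
  have : (Finset.univ : Finset ℤˣ) = {1, -1} := rfl
  rw [this, Finset.sum_pair (by decide)]
  rfl

/-- The **contraction principle** for Rademacher averages of a finite family of vectors. -/
theorem sum_signs_iSup_lipschitz_le [Nonempty ι] {φ : ℝ → ℝ} {L : ℝ}
    (hφ : ∀ u v, |φ u - φ v| ≤ L * |u - v|) (n : ℕ) (b : ι → ℝ) (a : ι → Fin n → ℝ) :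
    ∑ σ : Fin n → ℤˣ, ⨆ i, (b i + ∑ k, ((σ k : ℤ) : ℝ) * φ (a i k))
      ≤ ∑ σ : Fin n → ℤˣ, ⨆ i, (b i + ∑ k, ((σ k : ℤ) : ℝ) * (L * a i k)) := by
  -- The offset has to vary: the induction hypothesis is used with `b ± φ (a · 0)`, and coordinate
  -- `0` is contracted afterwards with the other terms as offset.
  induction n generalizing b with
  | zero => simp
  | succ n ih =>
    simp only [sum_signs_succ, Fin.sum_univ_succ, Fin.cons_zero, Fin.cons_succ, Units.val_one,
      Units.val_neg, Int.cast_one, Int.cast_neg, one_mul, neg_mul]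
    have h1 := ih (fun i => b i + φ (a i 0)) fun i k => a i k.succ
    have h2 := ih (fun i => b i - φ (a i 0)) fun i k => a i k.succ
    calc _ = ∑ σ : Fin n → ℤˣ,
            (⨆ i, (b i + φ (a i 0) + ∑ k : Fin n, ((σ k : ℤ) : ℝ) * φ (a i k.succ)))
          + ∑ σ : Fin n → ℤˣ,
            ⨆ i, (b i - φ (a i 0) + ∑ k : Fin n, ((σ k : ℤ) : ℝ) * φ (a i k.succ)) := by
          rw [← Finset.sum_add_distrib]
          simp only [sub_eq_add_neg, add_assoc]
      _ ≤ _ := add_le_add h1 h2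
      _ = ∑ σ : Fin n → ℤˣ,
            ((⨆ i, ((b i + ∑ k : Fin n, ((σ k : ℤ) : ℝ) * (L * a i k.succ)) + φ (a i 0)))
            + ⨆ i, ((b i + ∑ k : Fin n, ((σ k : ℤ) : ℝ) * (L * a i k.succ)) - φ (a i 0))) := by
          rw [← Finset.sum_add_distrib]
          simp only [sub_eq_add_neg, add_right_comm]
      _ ≤ _ := by
          refine Finset.sum_le_sum fun σ _ => (iSup_add_iSup_sub_le hφ _ _).trans (le_of_eq ?_)
          simp only [sub_eq_add_neg, add_comm, add_left_comm]

end Contraction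

/-! ### Symmetrization -/

section Symmetrization

variable {X ι : Type*} [MeasurableSpace X] [Finite ι]

lemma abs_iSup_le_of_abs_le [Nonempty ι] {a : ι → ℝ} {B : ℝ} (h : ∀ i, |a i| ≤ B) :
    |⨆ i, a i| ≤ B := by
  obtain ⟨i₀⟩ := ‹Nonempty ι›
  have : Nonempty ι := ⟨i₀⟩
  exact abs_le.2 ⟨(abs_le.1 (h i₀)).1.trans (le_iSup_of_finite a i₀),
    ciSup_le fun i => (abs_le.1 (h i)).2⟩

lemma iSup_mono_of_finite {a b : ι → ℝ} (h : ∀ i, a i ≤ b i) : ⨆ i, a i ≤ ⨆ i, b i :=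
  ciSup_mono (Set.finite_range b).bddAbove h

lemma abs_sum_le_card_mul {n : ℕ} {a : Fin n → ℝ} {B : ℝ} (h : ∀ k, |a k| ≤ B) :
    |∑ k, a k| ≤ n * B := by
  refine (Finset.abs_sum_le_sum_abs _ _).trans ((Finset.sum_le_sum fun k _ => h k).trans ?_)
  simp

/-- The Rademacher average of `h` over a sample `x`, without normalisation or absolute values. -/
noncomputable def signedSup {n : ℕ} (h : ι → X → ℝ) (σ : Fin n → ℤˣ) (x : Fin n → X) : ℝ :=
  ⨆ i, ∑ k, ((σ k : ℤ) : ℝ) * h i (x k)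

/-- The largest deviation of an empirical mean below the mean. -/
noncomputable def deviation (P : Measure X) {n : ℕ} (h : ι → X → ℝ) (x : Fin n → X) : ℝ :=
  ⨆ i, (∫ z, h i z ∂P - (1 / (n : ℝ)) * ∑ k, h i (x k))

lemma abs_sign_mul (u : ℤˣ) (a : ℝ) : |((u : ℤ) : ℝ) * a| = |a| := by
  rcases Int.units_eq_one_or u with rfl | rfl <;> simp

variable {h : ι → X → ℝ} {n : ℕ}

lemma measurable_signedSup (hm : ∀ i, Measurable (h i)) (σ : Fin n → ℤˣ) :
    Measurable (signedSup h σ) := by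
  have : Countable ι := Finite.to_countable
  refine Measurable.iSup fun i => Finset.measurable_sum _ fun k _ => ?_
  exact ((hm i).comp (measurable_pi_apply k)).const_mul _

omit [MeasurableSpace X] in
lemma abs_signedSup_le [Nonempty ι] (hB : ∀ i x, |h i x| ≤ 1) (σ : Fin n → ℤˣ) (x : Fin n → X) :
    |signedSup h σ x| ≤ n * 1 :=
  abs_iSup_le_of_abs_le fun i => abs_sum_le_card_mul fun k => by
    rw [abs_sign_mul]; exact hB i _

lemma measurable_deviation (P : Measure X) (hm : ∀ i, Measurable (h i)) :
    Measurable (deviation P (n := n) h) := by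
  have : Countable ι := Finite.to_countable
  refine Measurable.iSup fun i => measurable_const.sub (Measurable.const_mul
    (Finset.measurable_sum _ fun k _ => ?_) _)
  exact (hm i).comp (measurable_pi_apply k)

lemma abs_deviation_le [Nonempty ι] (P : Measure X) [IsProbabilityMeasure P] (hn : 0 < n)
    (hB : ∀ i x, |h i x| ≤ 1) (x : Fin n → X) : |deviation P h x| ≤ 2 := by
  have hn' : (0 : ℝ) < n := by exact_mod_cast hn
  refine abs_iSup_le_of_abs_le fun i => (abs_sub _ _).trans ?_
  have h1 : |∫ z, h i z ∂P| ≤ 1 := abs_integral_le_of_abs_le (hB i)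
  have h2 : |(1 / (n : ℝ)) * ∑ k, h i (x k)| ≤ 1 := by
    rw [abs_mul, abs_of_pos (by positivity : (0 : ℝ) < 1 / n)]
    have := abs_sum_le_card_mul fun k => hB i (x k)
    rw [one_div, inv_mul_le_iff₀ hn']
    exact this
  linarith

/-- **Symmetrization**: the mean of the largest deviation is at most twice the Rademacher
average. -/
theorem integral_deviation_le [Nonempty ι] (P : Measure X) [IsProbabilityMeasure P] (hn : 0 < n)
    (hm : ∀ i, Measurable (h i)) (hB : ∀ i x, |h i x| ≤ 1) :
    ∫ x, deviation P h x ∂(Measure.pi fun _ : Fin n => P)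
      ≤ ∫ x, (∑ σ : Fin n → ℤˣ, (2 / (n : ℝ)) * signedSup h σ x) / 2 ^ n
          ∂(Measure.pi fun _ : Fin n => P) := by
  have hn' : (0 : ℝ) < n := by exact_mod_cast hn
  have hcount : Countable ι := Finite.to_countable
  set Q := Measure.pi fun _ : Fin n => P
  set Q2 := Measure.pi fun _ : Fin n => P.prod P
  have hfst : MeasurePreserving (fun (z : Fin n → X × X) k => (z k).1) Q2 Q :=
    measurePreserving_pi _ _ fun _ => measurePreserving_fst
  have hsnd : MeasurePreserving (fun (z : Fin n → X × X) k => (z k).2) Q2 Q :=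
    measurePreserving_pi _ _ fun _ => measurePreserving_snd
  -- the deviation between two independent samples, with signs
  let D : (Fin n → ℤˣ) → (Fin n → X × X) → ℝ := fun σ z =>
    ⨆ i, ∑ k, ((σ k : ℤ) : ℝ) * (h i (z k).2 - h i (z k).1)
  have hDm : ∀ σ, Measurable (D σ) := fun σ =>
    Measurable.iSup fun i => Finset.measurable_sum _ fun k _ =>
      (((hm i).comp (measurable_snd.comp (measurable_pi_apply k))).sub
        ((hm i).comp (measurable_fst.comp (measurable_pi_apply k)))).const_mul _
  have hDB : ∀ σ z, |D σ z| ≤ n * 2 := fun σ z =>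
    abs_iSup_le_of_abs_le fun i => abs_sum_le_card_mul fun k => by
      rw [abs_sign_mul]
      exact (abs_sub _ _).trans (by linarith [hB i (z k).2, hB i (z k).1])
  -- signs do not change the mean
  have hswap : ∀ σ, ∫ z, D σ z ∂Q2 = ∫ z, D 1 z ∂Q2 := by
    intro σ
    -- Exchanging the two copies of the `k`-th point preserves the product law and flips the sign of
    -- the `k`-th difference.
    let sw : (Fin n → X × X) → (Fin n → X × X) := fun z k =>
      if σ k = 1 then z k else (z k).swap
    have hsw : MeasurePreserving sw Q2 Q2 := by
      refine measurePreserving_pi (f := fun k (p : X × X) => if σ k = 1 then p else p.swap)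
        _ _ fun k => ?_
      by_cases hk : σ k = 1
      · simp only [hk, if_true]; exact MeasurePreserving.id _
      · simp only [hk, if_false]; exact Measure.measurePreserving_swap
    have hD : ∀ z, D σ z = D 1 (sw z) := by
      intro z
      simp only [D]
      congr 1; ext i
      refine Finset.sum_congr rfl fun k _ => ?_
      simp only [sw, Pi.one_apply, Units.val_one, Int.cast_one, one_mul]
      rcases Int.units_eq_one_or (σ k) with hk | hk
      · simp [hk]
      · simp [hk]
    have : ∫ z, D 1 z ∂Q2 = ∫ z, D 1 (sw z) ∂Q2 := by
      conv_lhs => rw [← hsw.map_eq]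
      exact integral_map hsw.aemeasurable (hDm 1).aestronglyMeasurable
    rw [this]
    exact integral_congr_ae (Filter.Eventually.of_forall hD)
  -- comparison of the deviation with that between two samples
  have hghost : ∫ x, deviation P h x ∂Q ≤ ∫ z, (1 / (n : ℝ)) * D 1 z ∂Q2 := by
    have hmp := measurePreserving_arrowProdEquivProdArrow X X (Fin n) (fun _ => P) (fun _ => P)
    let e := MeasurableEquiv.arrowProdEquivProdArrow X X (Fin n)
    have hDi : Integrable (fun z => (1 / (n : ℝ)) * D 1 (e.symm z)) (Q.prod Q) :=
      (integrable_of_abs_le ((hDm 1).comp e.symm.measurable) fun z => hDB 1 _).const_mul _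
    have : ∫ z, (1 / (n : ℝ)) * D 1 z ∂Q2
        = ∫ z, (1 / (n : ℝ)) * D 1 (e.symm z) ∂(Q.prod Q) :=
      (hmp.symm.integral_comp e.symm.measurableEmbedding _).symm
    rw [this, integral_prod _ hDi]
    refine integral_mono (integrable_of_abs_le (measurable_deviation P hm)
      (abs_deviation_le P hn hB)) hDi.integral_prod_left fun x => ?_
    -- For a fixed first sample, each mean is an average over the second sample, and the supremum of
    -- averages is at most the average of suprema.
    refine ciSup_le fun i => ?_
    have hik : ∀ k, Integrable (fun y : Fin n → X => h i (y k)) Q := fun k =>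
      integrable_of_abs_le ((hm i).comp (measurable_pi_apply k)) fun y => hB i _
    have hev : ∀ k, ∫ y : Fin n → X, h i (y k) ∂Q = ∫ z, h i z ∂P := fun k => by
      have hk := measurePreserving_eval (fun _ : Fin n => P) k
      conv_rhs => rw [← hk.map_eq]
      exact (integral_map hk.aemeasurable (hm i).aestronglyMeasurable).symm
    have hlhs : ∫ z, h i z ∂P - (1 / (n : ℝ)) * ∑ k, h i (x k)
        = ∫ y, (1 / (n : ℝ)) * ∑ k, (h i (y k) - h i (x k)) ∂Q := by
      have hsub : ∀ k ∈ Finset.univ, Integrable (fun y : Fin n → X => h i (y k) - h i (x k)) Q :=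
        fun k _ => (hik k).sub (integrable_const _)
      rw [integral_const_mul, integral_finsetSum _ hsub]
      have : ∀ k, ∫ y : Fin n → X, (h i (y k) - h i (x k)) ∂Q = ∫ z, h i z ∂P - h i (x k) :=
        fun k => by rw [integral_sub (hik k) (integrable_const _), hev]; simp
      simp only [this, Finset.sum_sub_distrib, Finset.sum_const, Finset.card_univ,
        Fintype.card_fin, nsmul_eq_mul]
      field_simp
    rw [hlhs]
    have hDy : Integrable (fun y => (1 / (n : ℝ)) * D 1 (e.symm (x, y))) Q :=
      (integrable_of_abs_le (((hDm 1).comp e.symm.measurable).comp measurable_prodMk_left)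
        fun z => hDB 1 _).const_mul _
    refine integral_mono ((integrable_finsetSum _ fun k _ =>
      (hik k).sub (integrable_const _)).const_mul _) hDy fun y => ?_
    refine mul_le_mul_of_nonneg_left ?_ (by positivity)
    have := le_iSup_of_finite (fun i => ∑ k, (((1 : Fin n → ℤˣ) k : ℤ) : ℝ)
      * (h i (e.symm (x, y) k).2 - h i (e.symm (x, y) k).1)) i
    refine le_trans (le_of_eq ?_) this
    refine Finset.sum_congr rfl fun k _ => ?_
    simp [e, MeasurableEquiv.arrowProdEquivProdArrow, Equiv.arrowProdEquivProdArrow]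
  -- splitting the two samples
  have hSi : ∀ σ, Integrable (signedSup h σ) Q := fun σ =>
    integrable_of_abs_le (measurable_signedSup hm σ) (abs_signedSup_le hB σ)
  have hsplit : ∀ σ, ∫ z, D σ z ∂Q2
      ≤ ∫ x, signedSup h σ x ∂Q + ∫ x, signedSup h (-σ) x ∂Q := by
    intro σ
    have h1 : ∫ x, signedSup h σ x ∂Q = ∫ z, signedSup h σ (fun k => (z k).2) ∂Q2 := by
      conv_lhs => rw [← hsnd.map_eq]
      exact integral_map hsnd.aemeasurable (measurable_signedSup hm σ).aestronglyMeasurable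
    have h2 : ∫ x, signedSup h (-σ) x ∂Q = ∫ z, signedSup h (-σ) (fun k => (z k).1) ∂Q2 := by
      conv_lhs => rw [← hfst.map_eq]
      exact integral_map hfst.aemeasurable (measurable_signedSup hm _).aestronglyMeasurable
    have i1 : Integrable (fun z : Fin n → X × X => signedSup h σ (fun k => (z k).2)) Q2 :=
      hsnd.integrable_comp_of_integrable (hSi σ)
    have i2 : Integrable (fun z : Fin n → X × X => signedSup h (-σ) (fun k => (z k).1)) Q2 :=
      hfst.integrable_comp_of_integrable (hSi _)
    rw [h1, h2, ← integral_add i1 i2]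
    refine integral_mono (integrable_of_abs_le (hDm σ) (hDB σ)) (i1.add i2) fun z => ?_
    refine ciSup_le fun i => ?_
    have a1 := le_iSup_of_finite (fun i => ∑ k, ((σ k : ℤ) : ℝ) * h i (z k).2) i
    have a2 := le_iSup_of_finite (fun i => ∑ k, (((-σ) k : ℤ) : ℝ) * h i (z k).1) i
    refine le_trans (le_of_eq ?_) (add_le_add a1 a2)
    rw [← Finset.sum_add_distrib]
    refine Finset.sum_congr rfl fun k _ => ?_
    simp only [Pi.neg_apply, Units.val_neg, Int.cast_neg]
    ring
  have hcard : (Fintype.card (Fin n → ℤˣ) : ℝ) = 2 ^ n := by simp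
  -- Summing over all signs merges the terms for `σ` and `-σ`, hence the `2`.
  have hmean : 2 ^ n * ∫ z, D 1 z ∂Q2 ≤ 2 * ∑ σ : Fin n → ℤˣ, ∫ x, signedSup h σ x ∂Q := by
    have : ∑ σ : Fin n → ℤˣ, ∫ z, D σ z ∂Q2 = 2 ^ n * ∫ z, D 1 z ∂Q2 := by
      simp only [hswap, Finset.sum_const, Finset.card_univ, nsmul_eq_mul, hcard]
    rw [← this]
    refine (Finset.sum_le_sum fun σ _ => hsplit σ).trans (le_of_eq ?_)
    have hneg : ∑ σ : Fin n → ℤˣ, ∫ x, signedSup h (-σ) x ∂Q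
        = ∑ σ : Fin n → ℤˣ, ∫ x, signedSup h σ x ∂Q :=
      Equiv.sum_comp (Equiv.neg (Fin n → ℤˣ)) fun σ => ∫ x, signedSup h σ x ∂Q
    rw [Finset.sum_add_distrib, hneg]
    ring
  rw [integral_div, integral_finsetSum _ fun σ _ => (hSi σ).const_mul _]
  simp only [integral_const_mul]
  rw [← Finset.mul_sum]
  rw [integral_const_mul] at hghost
  refine hghost.trans ?_
  rw [le_div_iff₀ (by positivity)]
  calc 1 / (n : ℝ) * (∫ z, D 1 z ∂Q2) * 2 ^ n = 1 / (n : ℝ) * (2 ^ n * ∫ z, D 1 z ∂Q2) := by ring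
    _ ≤ 1 / (n : ℝ) * (2 * ∑ σ : Fin n → ℤˣ, ∫ x, signedSup h σ x ∂Q) :=
        mul_le_mul_of_nonneg_left hmean (by positivity)
    _ = _ := by ring

end Symmetrization

/-! ### The margin bound for one class of functions -/

section Ramp

/-- The ramp loss of width `γ`. -/
noncomputable def ramp (γ t : ℝ) : ℝ := max 0 (min 1 (1 - t / γ))

lemma ramp_nonneg (γ t : ℝ) : 0 ≤ ramp γ t := le_max_left _ _

lemma ramp_le_one (γ t : ℝ) : ramp γ t ≤ 1 := max_le zero_le_one (min_le_left _ _)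

lemma abs_ramp_le_one (γ t : ℝ) : |ramp γ t| ≤ 1 :=
  (abs_of_nonneg (ramp_nonneg γ t)).trans_le (ramp_le_one γ t)

lemma ramp_of_nonpos {γ t : ℝ} (hγ : 0 < γ) (ht : t ≤ 0) : ramp γ t = 1 := by
  have : t / γ ≤ 0 := div_nonpos_of_nonpos_of_nonneg ht hγ.le
  rw [ramp, min_eq_left (by linarith), max_eq_right zero_le_one]

lemma ramp_le_indicator {γ t : ℝ} (hγ : 0 < γ) : ramp γ t ≤ if t ≤ γ then 1 else 0 := by
  split_ifs with h
  · exact ramp_le_one γ t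
  · have : 1 < t / γ := (one_lt_div hγ).2 (not_le.1 h)
    exact max_le le_rfl ((min_le_right _ _).trans (by linarith))

lemma continuous_ramp (γ : ℝ) : Continuous (ramp γ) := by
  unfold ramp; fun_prop

lemma measurable_ramp (γ : ℝ) : Measurable (ramp γ) := (continuous_ramp γ).measurable

lemma abs_ramp_sub_ramp_le {γ : ℝ} (hγ : 0 < γ) (u v : ℝ) :
    |ramp γ u - ramp γ v| ≤ 1 / γ * |u - v| := by
  have h1 := abs_max_sub_max_le_max 0 (min 1 (1 - u / γ)) 0 (min 1 (1 - v / γ))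
  have h2 := abs_min_sub_min_le_max 1 (1 - u / γ) 1 (1 - v / γ)
  simp only [sub_self, abs_zero, abs_nonneg, sup_of_le_right] at h1 h2
  refine (h1.trans h2).trans (le_of_eq ?_)
  rw [show 1 - u / γ - (1 - v / γ) = 1 / γ * (v - u) by ring, abs_mul,
    abs_of_pos (by positivity : 0 < 1 / γ), abs_sub_comm]

end Ramp

section SingleClass

variable {X ι : Type*} [MeasurableSpace X]

/-- Values in `[0, 1]`, rather than `[-1, 1]`, make the differences `1/n` and not `2/n`. -/
lemma deviation_sub_le [Finite ι] [Nonempty ι] (P : Measure X) {n : ℕ} {h : ι → X → ℝ}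
    (h0 : ∀ i x, 0 ≤ h i x) (h1 : ∀ i x, h i x ≤ 1) (x y : Fin n → X) (k : Fin n)
    (hxy : ∀ j, j ≠ k → x j = y j) : deviation P h x - deviation P h y ≤ 1 / (n : ℝ) := by
  rw [sub_le_iff_le_add]
  refine ciSup_le fun i => ?_
  have hi := le_iSup_of_finite (fun i => ∫ z, h i z ∂P - (1 / (n : ℝ)) * ∑ k, h i (y k)) i
  have hs : ∑ j, h i (y j) - ∑ j, h i (x j) ≤ 1 := by
    rw [← Finset.sum_sub_distrib, Finset.sum_eq_single k
      (fun j _ hj => by rw [hxy j hj, sub_self]) fun hk => absurd (Finset.mem_univ _) hk]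
    linarith [h0 i (x k), h1 i (y k)]
  have hs' := mul_le_mul_of_nonneg_left hs (by positivity : (0 : ℝ) ≤ 1 / n)
  have : ∫ z, h i z ∂P - (1 / (n : ℝ)) * ∑ k, h i (y k) ≤ deviation P h y := hi
  linarith

omit [MeasurableSpace X] in
-- Contraction at a fixed sample. The absolute values enter only after the ramp is removed, so they
-- cost no factor `2`.
lemma sum_signedSup_ramp_le [Finite ι] [Nonempty ι] {n : ℕ} {γ : ℝ} (hγ : 0 < γ)
    (g : ι → X → ℝ) (F : Set (X → ℝ)) (hg : ∀ i, g i ∈ F) (x : Fin n → X) :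
    ENNReal.ofReal ((∑ σ : Fin n → ℤˣ, (2 / (n : ℝ)) * signedSup (fun i z => ramp γ (g i z)) σ x)
        / 2 ^ n)
      ≤ ENNReal.ofReal (1 / γ) * ((∑ σ : Fin n → ℤˣ,
          ⨆ u ∈ F, ENNReal.ofReal |(2 / (n : ℝ)) * ∑ k, ((σ k : ℤ) : ℝ) * u (x k)|) / 2 ^ n) := by
  have hc := sum_signs_iSup_lipschitz_le (abs_ramp_sub_ramp_le hγ) n (fun _ : ι => 0)
    fun i k => g i (x k)
  simp only [zero_add] at hc
  have hs : ∀ σ : Fin n → ℤˣ, 2 / (n : ℝ) * ⨆ i, ∑ k, ((σ k : ℤ) : ℝ) * (1 / γ * g i (x k))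
      ≤ 1 / γ * ⨆ i, |(2 / (n : ℝ)) * ∑ k, ((σ k : ℤ) : ℝ) * g i (x k)| := by
    intro σ
    rw [Real.mul_iSup_of_nonneg (by positivity), Real.mul_iSup_of_nonneg (by positivity)]
    refine iSup_mono_of_finite fun i => ?_
    have h1 : 2 / (n : ℝ) * ∑ k, ((σ k : ℤ) : ℝ) * (1 / γ * g i (x k))
        = 1 / γ * (2 / (n : ℝ) * ∑ k, ((σ k : ℤ) : ℝ) * g i (x k)) := by
      rw [Finset.mul_sum, Finset.mul_sum, Finset.mul_sum]
      exact Finset.sum_congr rfl fun k _ => by ring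
    rw [h1]
    exact mul_le_mul_of_nonneg_left (le_abs_self _) (by positivity)
  have hsup : ∀ σ : Fin n → ℤˣ,
      ENNReal.ofReal (⨆ i, |(2 / (n : ℝ)) * ∑ k, ((σ k : ℤ) : ℝ) * g i (x k)|)
        ≤ ⨆ u ∈ F, ENNReal.ofReal |(2 / (n : ℝ)) * ∑ k, ((σ k : ℤ) : ℝ) * u (x k)| := by
    intro σ
    obtain ⟨i, hi⟩ := exists_eq_ciSup_of_finite
      (f := fun i => |(2 / (n : ℝ)) * ∑ k, ((σ k : ℤ) : ℝ) * g i (x k)|)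
    rw [← hi]
    exact le_iSup₂ (f := fun u (_ : u ∈ F) =>
      ENNReal.ofReal |(2 / (n : ℝ)) * ∑ k, ((σ k : ℤ) : ℝ) * u (x k)|) (g i) (hg i)
  have hreal : (∑ σ : Fin n → ℤˣ, (2 / (n : ℝ)) * signedSup (fun i z => ramp γ (g i z)) σ x)
      / 2 ^ n ≤ 1 / γ * ((∑ σ : Fin n → ℤˣ,
        ⨆ i, |(2 / (n : ℝ)) * ∑ k, ((σ k : ℤ) : ℝ) * g i (x k)|) / 2 ^ n) := by
    rw [← mul_div_assoc]
    refine div_le_div_of_nonneg_right ?_ (by positivity)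
    rw [← Finset.mul_sum, Finset.mul_sum (a := 1 / γ)]
    refine (mul_le_mul_of_nonneg_left hc (by positivity)).trans ?_
    rw [Finset.mul_sum]
    exact Finset.sum_le_sum fun σ _ => hs σ
  refine (ENNReal.ofReal_le_ofReal hreal).trans ?_
  rw [ENNReal.ofReal_mul (by positivity),
    ENNReal.ofReal_div_of_pos (y := (2 : ℝ) ^ n) (by positivity),
    ENNReal.ofReal_sum_of_nonneg fun σ _ => Real.iSup_nonneg fun i => abs_nonneg _,
    ENNReal.ofReal_pow (by norm_num)]
  simp only [ENNReal.ofReal_ofNat]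
  gcongr
  exact hsup _

lemma integral_deviation_ramp_le [Finite ι] [Nonempty ι] (P : Measure X) [IsProbabilityMeasure P]
    {n : ℕ} (hn : 0 < n) {γ : ℝ} (hγ : 0 < γ) (g : ι → X → ℝ) (hm : ∀ i, Measurable (g i))
    (F : Set (X → ℝ)) (hg : ∀ i, g i ∈ F) (hR : rademacher P n F ≠ ⊤) :
    ∫ x, deviation P (fun i z => ramp γ (g i z)) x ∂(Measure.pi fun _ : Fin n => P)
      ≤ (rademacher P n F).toReal / γ := by
  have hm' : ∀ i, Measurable fun z => ramp γ (g i z) := fun i => (measurable_ramp γ).comp (hm i)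
  have hB : ∀ i z, |ramp γ (g i z)| ≤ 1 := fun i z => abs_ramp_le_one _ _
  refine (integral_deviation_le P hn hm' hB).trans ?_
  have hint : Integrable (fun x => (∑ σ : Fin n → ℤˣ,
      (2 / (n : ℝ)) * signedSup (fun i z => ramp γ (g i z)) σ x) / 2 ^ n)
      (Measure.pi fun _ : Fin n => P) :=
    (integrable_finsetSum _ fun σ _ => (integrable_of_abs_le (measurable_signedSup hm' σ)
      (abs_signedSup_le hB σ)).const_mul _).div_const _
  -- Dropping the negative part leaves a comparison of lower integrals, which needs no measurability
  -- of the supremum over `F`.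
  rw [integral_eq_lintegral_pos_part_sub_lintegral_neg_part hint]
  refine (sub_le_self _ ENNReal.toReal_nonneg).trans ?_
  have hle : ∫⁻ x, ENNReal.ofReal ((∑ σ : Fin n → ℤˣ,
      (2 / (n : ℝ)) * signedSup (fun i z => ramp γ (g i z)) σ x) / 2 ^ n)
      ∂(Measure.pi fun _ : Fin n => P) ≤ ENNReal.ofReal (1 / γ) * rademacher P n F := by
    rw [rademacher, ← lintegral_const_mul' _ _ ENNReal.ofReal_ne_top]
    exact lintegral_mono fun x => sum_signedSup_ramp_le hγ g F hg x
  refine (ENNReal.toReal_mono (ENNReal.mul_ne_top ENNReal.ofReal_ne_top hR) hle).trans ?_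
  rw [ENNReal.toReal_mul, ENNReal.toReal_ofReal (by positivity)]
  exact le_of_eq (by ring)

/-- The samples on which some function of `F₀` has a ramp risk exceeding its empirical ramp risk by
more than `c`. -/
def rampFailure (P : Measure X) {n : ℕ} (F₀ : Set (X → ℝ)) (γ c : ℝ) : Set (Fin n → X) :=
  {x | ∃ g ∈ F₀, (1 / (n : ℝ)) * ∑ k, ramp γ (g (x k)) + c < ∫ z, ramp γ (g z) ∂P}

lemma measurableSet_rampFailure (P : Measure X) {n : ℕ} {F₀ : Set (X → ℝ)} (hc : F₀.Countable)
    (hm : ∀ g ∈ F₀, Measurable g) (γ c : ℝ) :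
    MeasurableSet (rampFailure P (n := n) F₀ γ c) := by
  have : rampFailure P (n := n) F₀ γ c
      = ⋃ g ∈ F₀, {x : Fin n → X | (1 / (n : ℝ)) * ∑ k, ramp γ (g (x k)) + c
          < ∫ z, ramp γ (g z) ∂P} := by
    ext x; simp [rampFailure]
  rw [this]
  refine MeasurableSet.biUnion hc fun g hg => measurableSet_lt ?_ measurable_const
  exact ((Finset.measurable_sum _ fun k _ => (measurable_ramp γ).comp
    ((hm g hg).comp (measurable_pi_apply k))).const_mul _).add_const _

/-- A failure forces the deviation above its mean by at least `t`, because the mean is at most the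
Rademacher term. -/
lemma measure_rampFailure_range_le [Finite ι] (P : Measure X) [IsProbabilityMeasure P]
    {n : ℕ} (hn : 0 < n) {γ : ℝ} (hγ : 0 < γ) (g : ι → X → ℝ) (hm : ∀ i, Measurable (g i))
    (F : Set (X → ℝ)) (hg : ∀ i, g i ∈ F) (hR : rademacher P n F ≠ ⊤) {t : ℝ} (ht : 0 ≤ t) :
    (Measure.pi fun _ : Fin n => P)
        (rampFailure P (Set.range g) γ ((rademacher P n F).toReal / γ + t))
      ≤ ENNReal.ofReal (Real.exp (-2 * n * t ^ 2)) := by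
  rcases isEmpty_or_nonempty ι with hι | hι
  · simp [rampFailure]
  have hm' : ∀ i, Measurable fun z => ramp γ (g i z) := fun i => (measurable_ramp γ).comp (hm i)
  have hmd := measureReal_ge_le_of_bounded_differences P hn _
    (measurable_deviation P (n := n) hm') (abs_deviation_le P hn fun i z => abs_ramp_le_one _ _)
    (deviation_sub_le P (fun i z => ramp_nonneg _ _) fun i z => ramp_le_one _ _) ht
  have hE := integral_deviation_ramp_le P hn hγ g hm F hg hR
  rw [← ENNReal.ofReal_toReal (measure_ne_top _ _)]
  refine ENNReal.ofReal_le_ofReal (le_trans (measureReal_mono fun x hx => ?_) hmd)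
  obtain ⟨_, ⟨i, rfl⟩, hi⟩ := hx
  have := le_iSup_of_finite (fun i => ∫ z, ramp γ (g i z) ∂P
    - (1 / (n : ℝ)) * ∑ k, ramp γ (g i (x k))) i
  rw [Set.mem_ofPred_eq]
  simp only [deviation] at *
  linarith

/-- The uniform margin bound over a countable class, for a fixed margin. -/
theorem measure_rampFailure_le (P : Measure X) [IsProbabilityMeasure P]
    {n : ℕ} (hn : 0 < n) {γ : ℝ} (hγ : 0 < γ) {F₀ F : Set (X → ℝ)} (hc : F₀.Countable)
    (hm : ∀ g ∈ F₀, Measurable g) (hF : F₀ ⊆ F) (hR : rademacher P n F ≠ ⊤) {t : ℝ}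
    (ht : 0 ≤ t) :
    (Measure.pi fun _ : Fin n => P) (rampFailure P F₀ γ ((rademacher P n F).toReal / γ + t))
      ≤ ENNReal.ofReal (Real.exp (-2 * n * t ^ 2)) := by
  rcases F₀.eq_empty_or_nonempty with rfl | hne
  · simp [rampFailure]
  obtain ⟨u, rfl⟩ := hc.exists_eq_range hne
  set c := (rademacher P n F).toReal / γ + t
  -- The threshold `c` uses the complexity of the whole `F`, so it is the same for all finite
  -- subfamilies and continuity from below applies.
  have hU : rampFailure P (n := n) (Set.range u) γ c
      = ⋃ m : ℕ, rampFailure P (Set.range fun i : Fin m => u i) γ c := by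
    ext x
    simp only [rampFailure, Set.mem_iUnion, Set.mem_ofPred_eq, Set.exists_range_iff]
    exact ⟨fun ⟨i, hi⟩ => ⟨i + 1, ⟨i, Nat.lt_succ_self i⟩, hi⟩, fun ⟨_, i, hi⟩ => ⟨i, hi⟩⟩
  have hmono : Monotone fun m : ℕ =>
      rampFailure P (n := n) (Set.range fun i : Fin m => u i) γ c := by
    rintro a b hab x ⟨_, ⟨i, rfl⟩, hi⟩
    exact ⟨_, ⟨⟨i, i.2.trans_le hab⟩, rfl⟩, hi⟩
  rw [hU, hmono.measure_iUnion]
  exact iSup_le fun m => measure_rampFailure_range_le P hn hγ _ (fun i => hm _ ⟨_, rfl⟩) F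
    (fun i => hF ⟨_, rfl⟩) hR ht

/-- Off the failure set, the bound extends to pointwise limits. -/
lemma integral_ramp_le_of_notMem_rampFailure (P : Measure X) [IsProbabilityMeasure P] {n : ℕ}
    {F₀ : Set (X → ℝ)} (hm : ∀ g ∈ F₀, Measurable g) {γ c : ℝ} {x : Fin n → X}
    (hx : x ∉ rampFailure P F₀ γ c) {g : X → ℝ} {u : ℕ → X → ℝ} (hu : ∀ m, u m ∈ F₀)
    (hlim : ∀ z, Filter.Tendsto (fun m => u m z) Filter.atTop (nhds (g z))) :
    ∫ z, ramp γ (g z) ∂P ≤ (1 / (n : ℝ)) * ∑ k, ramp γ (g (x k)) + c := by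
  have hr : ∀ z, Filter.Tendsto (fun m => ramp γ (u m z)) Filter.atTop (nhds (ramp γ (g z))) :=
    fun z => ((continuous_ramp γ).tendsto _).comp (hlim z)
  have h1 : Filter.Tendsto (fun m => ∫ z, ramp γ (u m z) ∂P) Filter.atTop
      (nhds (∫ z, ramp γ (g z) ∂P)) :=
    tendsto_integral_of_dominated_convergence (fun _ => 1)
      (fun m => ((measurable_ramp γ).comp (hm _ (hu m))).aestronglyMeasurable)
      (integrable_const _) (fun m => Filter.Eventually.of_forall fun z => abs_ramp_le_one _ _)
      (Filter.Eventually.of_forall hr)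
  have h2 : Filter.Tendsto (fun m => (1 / (n : ℝ)) * ∑ k, ramp γ (u m (x k)) + c) Filter.atTop
      (nhds ((1 / (n : ℝ)) * ∑ k, ramp γ (g (x k)) + c)) :=
    ((tendsto_finsetSum _ fun k _ => hr (x k)).const_mul _).add_const _
  exact le_of_tendsto_of_tendsto' h1 h2 fun m => not_lt.1 fun h => hx ⟨u m, hu m, h⟩

end SingleClass

/-! ### Conditioning on the labels -/

section Conditioning

variable {X : Type*} [MeasurableSpace X] {C N : ℕ}

lemma measurableSet_label (i : Fin C) : MeasurableSet {z : X × Fin C | z.2 = i} :=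
  measurable_snd (measurableSet_singleton i)

lemma classProb_pos_iff (μ : Measure (X × Fin C)) [IsProbabilityMeasure μ] {i : Fin C} :
    0 < classProb μ i ↔ μ {z | z.2 = i} ≠ 0 := by
  rw [classProb, measureReal_def, ENNReal.toReal_pos_iff]
  exact ⟨fun h => h.1.ne', fun h => ⟨pos_iff_ne_zero.2 h, measure_lt_top _ _⟩⟩

lemma isProbabilityMeasure_classCond (μ : Measure (X × Fin C)) [IsProbabilityMeasure μ]
    {i : Fin C} (hi : 0 < classProb μ i) : IsProbabilityMeasure (classCond μ i) := by
  have := cond_isProbabilityMeasure ((classProb_pos_iff μ).1 hi)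
  exact Measure.isProbabilityMeasure_map measurable_fst.aemeasurable

/-- The points with label `i`, when the labels are `y`, in increasing order of their indices. -/
def subsample (y : Fin N → Fin C) (i : Fin C) (S : Fin N → X × Fin C) :
    Fin (Finset.univ.filter fun k => y k = i).card → X :=
  fun m => (S ((Finset.univ.filter fun k => y k = i).orderEmbOfFin rfl m)).1

/-- The sample points of class `i`. -/
def classSample (S : Fin N → X × Fin C) (i : Fin C) : Fin (classCount S i) → X :=
  subsample (fun k => (S k).2) i S

omit [MeasurableSpace X] in
lemma sum_classSample (S : Fin N → X × Fin C) (i : Fin C) (φ : X → ℝ) :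
    ∑ m, φ (classSample S i m) = ∑ k ∈ Finset.univ.filter (fun k => (S k).2 = i), φ (S k).1 := by
  conv_rhs => rw [← Finset.map_orderEmbOfFin_univ (Finset.univ.filter fun k => (S k).2 = i) rfl]
  rw [Finset.sum_map]
  rfl

lemma measurable_subsample (y : Fin N → Fin C) (i : Fin C) :
    Measurable (subsample (X := X) y i) :=
  measurable_pi_lambda _ fun _ => measurable_fst.comp (measurable_pi_apply _)

/-- The event that the labels are `y`. -/
def labelEvent (X : Type*) (y : Fin N → Fin C) : Set (Fin N → X × Fin C) :=
  (fun S k => (S k).2) ⁻¹' {y}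

lemma measurableSet_labelEvent (y : Fin N → Fin C) : MeasurableSet (labelEvent X y) :=
  (measurable_pi_lambda _ fun _ => measurable_snd.comp (measurable_pi_apply _))
    (measurableSet_singleton y)

omit [MeasurableSpace X] in
lemma labelEvent_eq_pi (y : Fin N → Fin C) :
    labelEvent X y = Set.univ.pi fun k => {z | z.2 = y k} := by
  ext S; simp [labelEvent, funext_iff]

/-- Given the labels, the points of class `i` are i.i.d. with law `classCond μ i`. -/
lemma measure_labelEvent_inter (μ : Measure (X × Fin C)) [IsProbabilityMeasure μ]
    (y : Fin N → Fin C) (i : Fin C)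
    {B : Set (Fin (Finset.univ.filter fun k => y k = i).card → X)} (hB : MeasurableSet B) :
    (Measure.pi fun _ : Fin N => μ) (labelEvent X y ∩ subsample y i ⁻¹' B)
      = (Measure.pi fun _ : Fin N => μ) (labelEvent X y)
        * (Measure.pi fun _ => classCond μ i) B := by
  have hL : (Measure.pi fun _ : Fin N => μ) (labelEvent X y) = ∏ k, μ {z | z.2 = y k} := by
    rw [labelEvent_eq_pi, Measure.pi_pi]
  -- If a label is null, conditioning on it gives no probability measure, but both sides vanish.
  by_cases h0 : ∃ k, μ {z | z.2 = y k} = 0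
  · obtain ⟨k, hk⟩ := h0
    have h : (Measure.pi fun _ : Fin N => μ) (labelEvent X y) = 0 := by
      rw [hL]; exact Finset.prod_eq_zero (Finset.mem_univ k) hk
    rw [h, zero_mul]
    exact measure_mono_null Set.inter_subset_left h
  push Not at h0
  have hprob : ∀ k, IsProbabilityMeasure (μ[|{z | z.2 = y k}]) := fun k =>
    cond_isProbabilityMeasure (h0 k)
  have hcond : (Measure.pi fun k => μ.restrict {z | z.2 = y k})
      = (∏ k, μ {z | z.2 = y k}) • Measure.pi fun k => μ[|{z | z.2 = y k}] := by
    refine Measure.pi_eq fun s hs => ?_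
    rw [Measure.smul_apply, Measure.pi_pi, smul_eq_mul, ← Finset.prod_mul_distrib]
    refine Finset.prod_congr rfl fun k _ => ?_
    rw [mul_comm, cond_mul_eq_inter (measurableSet_label _), Measure.restrict_apply (hs k),
      Set.inter_comm]
  have hmap : (Measure.pi fun k => μ[|{z | z.2 = y k}]).map (subsample y i)
      = Measure.pi fun _ => classCond μ i := by
    -- Independent coordinates stay independent when selected along the injective enumeration of the
    -- indices with label `i`.
    have hind := (iIndepFun_pi (μ := fun k => μ[|{z | z.2 = y k}])
      (X := fun _ => Prod.fst) fun _ => measurable_fst.aemeasurable).precomp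
      ((Finset.univ.filter fun k => y k = i).orderEmbOfFin rfl).injective
    have := (iIndepFun_iff_map_fun_eq_pi_map fun m => (measurable_fst.comp
      (measurable_pi_apply _)).aemeasurable).1 hind
    refine Eq.trans this ?_
    congr 1
    funext m
    have hm : y ((Finset.univ.filter fun k => y k = i).orderEmbOfFin rfl m) = i :=
      (Finset.mem_filter.1 (Finset.orderEmbOfFin_mem _ rfl m)).2
    set k := (Finset.univ.filter fun k => y k = i).orderEmbOfFin rfl m
    have hev := (measurePreserving_eval (fun k => μ[|{z | z.2 = y k}]) k).map_eq
    calc (Measure.pi fun k => μ[|{z | z.2 = y k}]).map (fun S => (S k).1)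
        = ((Measure.pi fun k => μ[|{z | z.2 = y k}]).map (Function.eval k)).map Prod.fst :=
          (Measure.map_map measurable_fst (measurable_pi_apply k)).symm
      _ = classCond μ i := by rw [hev, classCond, hm]
  have hT : MeasurableSet (subsample (X := X) y i ⁻¹' B) := measurable_subsample y i hB
  rw [Set.inter_comm, ← Measure.restrict_apply hT, labelEvent_eq_pi, Measure.restrict_pi_pi,
    hcond, Measure.smul_apply, smul_eq_mul, Measure.pi_pi, ← hmap,
    Measure.map_apply (measurable_subsample y i) hB]

/-- The event that class `i` is represented and its sample points lie in a given set. -/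
def classEvent (N : ℕ) (i : Fin C) (B : ∀ n, Set (Fin n → X)) : Set (Fin N → X × Fin C) :=
  {S | 0 < classCount S i ∧ classSample S i ∈ B (classCount S i)}

omit [MeasurableSpace X] in
-- Fixing the labels fixes `N_i`, and with it the space in which the class sample lives.
lemma classEvent_eq_iUnion (i : Fin C) (B : ∀ n, Set (Fin n → X)) :
    classEvent N i B = ⋃ y : Fin N → Fin C, labelEvent X y ∩
      {S | 0 < (Finset.univ.filter fun k => y k = i).card ∧ subsample y i S ∈ B _} := by
  ext S
  simp only [Set.mem_iUnion]
  constructor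
  · intro h
    exact ⟨fun k => (S k).2, rfl, h⟩
  · rintro ⟨y, hy, h⟩
    obtain rfl : (fun k => (S k).2) = y := hy
    exact h

lemma measurableSet_classEvent (i : Fin C) {B : ∀ n, Set (Fin n → X)}
    (hB : ∀ n, MeasurableSet (B n)) : MeasurableSet (classEvent N i B) := by
  rw [classEvent_eq_iUnion]
  exact MeasurableSet.iUnion fun y => (measurableSet_labelEvent y).inter
    ((MeasurableSet.const _).inter (measurable_subsample y i (hB _)))

/-- The law of total probability over the label vectors; it suffices that `ε` does not depend on
`n`. -/
lemma measure_classEvent_le (μ : Measure (X × Fin C)) [IsProbabilityMeasure μ] (i : Fin C)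
    {B : ∀ n, Set (Fin n → X)} (hB : ∀ n, MeasurableSet (B n)) {ε : ℝ≥0∞}
    (hε : ∀ n, 0 < n → (Measure.pi fun _ : Fin n => classCond μ i) (B n) ≤ ε) :
    (Measure.pi fun _ : Fin N => μ) (classEvent N i B) ≤ ε := by
  rw [classEvent_eq_iUnion]
  refine (measure_iUnion_le _).trans ?_
  rw [tsum_fintype]
  have hy : ∀ y : Fin N → Fin C, (Measure.pi fun _ : Fin N => μ) (labelEvent X y ∩
      {S | 0 < (Finset.univ.filter fun k => y k = i).card ∧ subsample y i S ∈ B _})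
      ≤ (Measure.pi fun _ : Fin N => μ) (labelEvent X y) * ε := by
    intro y
    by_cases h : 0 < (Finset.univ.filter fun k => y k = i).card
    · refine (measure_mono (t := labelEvent X y ∩ subsample y i ⁻¹' B _) fun S hS =>
        ⟨hS.1, hS.2.2⟩).trans ?_
      rw [measure_labelEvent_inter μ y i (hB _)]
      gcongr
      exact hε _ h
    · refine le_of_eq_of_le ?_ (zero_le (a := _))
      convert measure_empty (μ := Measure.pi fun _ : Fin N => μ)
      ext S
      simp only [Set.mem_inter_iff, Set.mem_ofPred_eq, Set.mem_empty_iff_false, iff_false]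
      exact fun hS => h hS.2.1
  refine (Finset.sum_le_sum fun y _ => hy y).trans ?_
  rw [← Finset.sum_mul]
  have h1 : ∑ y : Fin N → Fin C, (Measure.pi fun _ : Fin N => μ) (labelEvent X y) = 1 := by
    simp only [labelEvent]
    rw [sum_measure_preimage_singleton _ fun y _ => measurableSet_labelEvent y]
    simp
  rw [h1, one_mul]

/-- A property of the points of class `i` that holds `classCond μ i`-almost surely holds for
almost all samples. -/
lemma ae_forall_sample (μ : Measure (X × Fin C)) [IsProbabilityMeasure μ] {p : Fin C → X → Prop}
    (hp : ∀ i, ∀ᵐ x ∂(classCond μ i), p i x) :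
    ∀ᵐ S ∂(Measure.pi fun _ : Fin N => μ), ∀ k, p (S k).2 (S k).1 := by
  have hμ : ∀ᵐ z ∂μ, p z.2 z.1 := by
    have h : ∀ i, ∀ᵐ z ∂μ, z.2 = i → p i z.1 := by
      intro i
      have h1 := ae_of_ae_map measurable_fst.aemeasurable (hp i)
      -- The normalising factor is never zero; for a null class it is `⊤`, and the restricted
      -- measure is zero anyway.
      rw [ProbabilityTheory.cond, Measure.ae_ennreal_smul_measure_iff
        (ENNReal.inv_ne_zero.2 (measure_ne_top _ _)), ae_restrict_iff' (measurableSet_label i)]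
        at h1
      exact h1
    filter_upwards [ae_all_iff.2 h] with z hz using hz _ rfl
  exact ae_all_iff.2 fun k => (Measure.quasiMeasurePreserving_eval (fun _ : Fin N => μ) k).ae hμ

end Conditioning

/-! ### The multiclass margin bound -/

section Multiclass

variable {X W : Type*} [MeasurableSpace X] {C d N : ℕ}

/-- Guards against `toReal` sending an infinite complexity to `0`. -/
lemma rademacher_ne_top (P : Measure X) [IsProbabilityMeasure P] (n : ℕ) {F : Set (X → ℝ)} {B : ℝ}
    (hF : ∀ᵐ x ∂P, ∀ g ∈ F, |g x| ≤ B) : rademacher P n F ≠ ⊤ := by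
  have hpi : ∀ᵐ x ∂(Measure.pi fun _ : Fin n => P), ∀ k, ∀ g ∈ F, |g (x k)| ≤ B :=
    ae_all_iff.2 fun k => (Measure.quasiMeasurePreserving_eval (fun _ : Fin n => P) k).ae hF
  have hle : rademacher P n F ≤ ∫⁻ _ : Fin n → X, (∑ _σ : Fin n → ℤˣ,
      ENNReal.ofReal (2 / (n : ℝ) * (n * B))) / 2 ^ n ∂(Measure.pi fun _ => P) := by
    refine lintegral_mono_ae ?_
    filter_upwards [hpi] with x hx
    gcongr with σ
    refine iSup₂_le fun g hg => ENNReal.ofReal_le_ofReal ?_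
    rw [abs_mul, abs_of_nonneg (by positivity : 0 ≤ 2 / (n : ℝ))]
    exact mul_le_mul_of_nonneg_left (abs_sum_le_card_mul fun k => by
      rw [abs_sign_mul]; exact hx k g hg) (by positivity)
  refine ne_top_of_le_ne_top ?_ hle
  rw [lintegral_const, measure_univ, mul_one]
  exact ENNReal.div_ne_top (ENNReal.sum_ne_top.2 fun _ _ => ENNReal.ofReal_ne_top) (by simp)

omit [MeasurableSpace X] in
lemma margin_eq_logit_sub (f : W → X → EuclideanSpace ℝ (Fin d)) (h : Classifier C d W)
    (i j : Fin C) (x : X) : margin f h i j x = logit f h i x - logit f h j x := by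
  simp [margin, logit, inner_sub_left]

lemma measurable_margin {f : W → X → EuclideanSpace ℝ (Fin d)} {h : Classifier C d W}
    (hf : Measurable (f h.2)) (i j : Fin C) : Measurable (margin f h i j) :=
  measurable_const.inner hf

omit [MeasurableSpace X] in
-- The hypothesis only controls margins that involve the true class `i`; any other margin is a
-- difference of two of these. The absolute value allows a negative `K`.
lemma abs_le_of_mem_marginClass {f : W → X → EuclideanSpace ℝ (Fin d)}
    {H : Set (Classifier C d W)} {K : ℝ} {i : Fin C} {x : X}
    (hx : ∀ h ∈ H, ∀ j, j ≠ i → |margin f h i j x| ≤ K) :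
    ∀ g ∈ marginClass f H, |g x| ≤ 2 * |K| := by
  rintro _ ⟨h, hh, a, b, -, rfl⟩
  have hj : ∀ j, |margin f h i j x| ≤ |K| := by
    intro j
    by_cases hji : j = i
    · subst hji; simp [margin]
    · exact (hx h hh j hji).trans (le_abs_self K)
  have : margin f h a b x = margin f h i b x - margin f h i a x := by
    simp only [margin_eq_logit_sub]; ring
  rw [this]
  exact (abs_sub _ _).trans (by linarith [hj a, hj b])

/-- The ramp width is existential for each pair, so that the uniform bound may use a dyadic width
below the given margin. -/
lemma misclassProb_le (μ : Measure (X × Fin C)) [IsProbabilityMeasure μ]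
    {f : W → X → EuclideanSpace ℝ (Fin d)} {h : Classifier C d W} (hf : Measurable (f h.2))
    {T : Fin C → Fin C → ℝ} (hT : ∀ i j, j ≠ i → 0 < classProb μ i →
      ∃ γ > 0, ∫ x, ramp γ (margin f h i j x) ∂(classCond μ i) ≤ T i j) :
    misclassProb μ f h ≤ ∑ i, classProb μ i * ∑ j ∈ Finset.univ.erase i, T i j := by
  have hset : {z : X × Fin C | ∃ c, c ≠ z.2 ∧ logit f h z.2 z.1 ≤ logit f h c z.1}
      ⊆ ⋃ i ∈ (Finset.univ : Finset (Fin C)), ⋃ j ∈ Finset.univ.erase i,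
        {z | z.2 = i} ∩ Prod.fst ⁻¹' {x | margin f h i j x ≤ 0} := by
    rintro ⟨x, i⟩ ⟨j, hj, hle⟩
    simp only [Set.mem_iUnion]
    refine ⟨i, Finset.mem_univ _, j, Finset.mem_erase.2 ⟨hj, Finset.mem_univ _⟩, rfl, ?_⟩
    change margin f h i j x ≤ 0
    rw [margin_eq_logit_sub]
    exact sub_nonpos.2 hle
  refine (measureReal_mono hset (measure_ne_top _ _)).trans ((measureReal_biUnion_finset_le _ _).trans ?_)
  refine Finset.sum_le_sum fun i _ => (measureReal_biUnion_finset_le _ _).trans ?_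
  rw [Finset.mul_sum]
  refine Finset.sum_le_sum fun j hj => ?_
  have hp0 : 0 ≤ classProb μ i := measureReal_nonneg
  rcases hp0.eq_or_lt with h0 | hpos
  · rw [← h0, zero_mul]
    exact (measureReal_mono Set.inter_subset_left).trans h0.ge
  have hprob := isProbabilityMeasure_classCond μ hpos
  obtain ⟨γ, hγ, hle⟩ := hT i j (Finset.ne_of_mem_erase hj) hpos
  have hm := measurable_margin hf i j
  have hms : MeasurableSet {x | margin f h i j x ≤ 0} := measurableSet_le hm measurable_const
  have h1 : μ.real ({z | z.2 = i} ∩ Prod.fst ⁻¹' {x | margin f h i j x ≤ 0})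
      = classProb μ i * (classCond μ i).real {x | margin f h i j x ≤ 0} := by
    rw [classProb, measureReal_def, ← cond_mul_eq_inter (measurableSet_label i), classCond,
      measureReal_def, measureReal_def, Measure.map_apply measurable_fst hms, ENNReal.toReal_mul,
      mul_comm]
  rw [h1]
  refine mul_le_mul_of_nonneg_left (le_trans ?_ hle) hpos.le
  rw [← integral_indicator_one hms]
  have hri : Integrable (fun x => ramp γ (margin f h i j x)) (classCond μ i) :=
    integrable_of_abs_le ((measurable_ramp γ).comp hm) fun x => abs_ramp_le_one _ _
  refine integral_mono ((integrable_const (1 : ℝ)).indicator hms) hri fun x => ?_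
  by_cases hx : margin f h i j x ≤ 0
  · rw [Set.indicator_of_mem (show x ∈ {x | margin f h i j x ≤ 0} from hx)]
    exact (ramp_of_nonpos hγ hx).ge
  · rw [Set.indicator_of_notMem (show x ∉ {x | margin f h i j x ≤ 0} from hx)]
    exact ramp_nonneg _ _

/-- The samples for which the margin bound of width `γ` with slack `τ` fails in class `i`. -/
def marginFailure (μ : Measure (X × Fin C)) (N : ℕ) (F F₀ : Set (X → ℝ)) (i : Fin C) (γ : ℝ)
    (τ : ℕ → ℝ) : Set (Fin N → X × Fin C) :=
  classEvent N i fun n => rampFailure (classCond μ i) F₀ γ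
    ((rademacher (classCond μ i) n F).toReal / γ + τ n)

lemma measurableSet_marginFailure (μ : Measure (X × Fin C)) {F F₀ : Set (X → ℝ)}
    (hc : F₀.Countable) (hm : ∀ g ∈ F₀, Measurable g) (i : Fin C) (γ : ℝ) (τ : ℕ → ℝ) :
    MeasurableSet (marginFailure μ N F F₀ i γ τ) :=
  measurableSet_classEvent i fun _ => measurableSet_rampFailure _ hc hm _ _

lemma measure_marginFailure_le (μ : Measure (X × Fin C)) [IsProbabilityMeasure μ]
    {F F₀ : Set (X → ℝ)} (hc : F₀.Countable) (hm : ∀ g ∈ F₀, Measurable g) (hF : F₀ ⊆ F)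
    {i : Fin C} (hi : 0 < classProb μ i) (hR : ∀ n, rademacher (classCond μ i) n F ≠ ⊤)
    {γ : ℝ} (hγ : 0 < γ) {τ : ℕ → ℝ} (hτ : ∀ n, 0 ≤ τ n) {ε : ℝ}
    (hε : ∀ n : ℕ, 0 < n → Real.exp (-2 * n * τ n ^ 2) ≤ ε) :
    (Measure.pi fun _ : Fin N => μ) (marginFailure μ N F F₀ i γ τ) ≤ ENNReal.ofReal ε := by
  have := isProbabilityMeasure_classCond μ hi
  exact measure_classEvent_le μ i (fun n => measurableSet_rampFailure _ hc hm _ _) fun n hn =>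
    (measure_rampFailure_le _ hn hγ hc hm hF (hR n) (hτ n)).trans
      (ENNReal.ofReal_le_ofReal (hε n hn))

/-- Off the failure event, the margin bound holds, with the empirical margin risk at any larger
margin. -/
lemma integral_ramp_le_of_notMem_marginFailure (μ : Measure (X × Fin C)) [IsProbabilityMeasure μ]
    {F F₀ : Set (X → ℝ)} (hm : ∀ g ∈ F₀, Measurable g)
    (hlim : ∀ g ∈ F, ∃ u : ℕ → X → ℝ, (∀ m, u m ∈ F₀) ∧
      ∀ x, Filter.Tendsto (fun m => u m x) Filter.atTop (nhds (g x)))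
    {i : Fin C} (hi : 0 < classProb μ i) {γ γ' : ℝ} (hγ' : 0 < γ') (hγ : γ' ≤ γ) {τ : ℕ → ℝ}
    {S : Fin N → X × Fin C} (hS : S ∉ marginFailure μ N F F₀ i γ' τ) (hn : 0 < classCount S i)
    {g : X → ℝ} (hg : g ∈ F) :
    ∫ x, ramp γ' (g x) ∂(classCond μ i)
      ≤ (rademacher (classCond μ i) (classCount S i) F).toReal / γ' + τ (classCount S i)
        + ∑ k ∈ Finset.univ.filter (fun k => (S k).2 = i),
          (if g (S k).1 ≤ γ then (1 : ℝ) else 0) / (classCount S i : ℝ) := by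
  have := isProbabilityMeasure_classCond μ hi
  obtain ⟨u, hu, hug⟩ := hlim g hg
  have h := integral_ramp_le_of_notMem_rampFailure (classCond μ i) hm
    (fun hx => hS ⟨hn, hx⟩) hu hug
  rw [sum_classSample S i fun x => ramp γ' (g x)] at h
  refine h.trans ?_
  rw [add_comm]
  refine add_le_add le_rfl ?_
  rw [Finset.mul_sum]
  refine Finset.sum_le_sum fun k _ => ?_
  rw [one_div, inv_mul_eq_div]
  refine div_le_div_of_nonneg_right ((ramp_le_indicator hγ').trans ?_) (by positivity)
  split_ifs with h1 h2
  · exact le_rfl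
  · exact absurd (h1.trans hγ) h2
  · exact zero_le_one
  · exact le_rfl

/-- A union bound over all pairs of distinct classes. -/
lemma exists_measurableSet_forall_notMem (μ : Measure (X × Fin C)) [IsProbabilityMeasure μ] {δ : ℝ}
    (hδ : 0 < δ) (E : Fin C → Fin C → Set (Fin N → X × Fin C))
    (hE : ∀ i j, MeasurableSet (E i j)) (hμ : ∀ i j, j ≠ i → 0 < classProb μ i →
      (Measure.pi fun _ : Fin N => μ) (E i j) ≤ ENNReal.ofReal (δ / ((C : ℝ) * ((C : ℝ) - 1)))) :
    ∃ A : Set (Fin N → X × Fin C), MeasurableSet A ∧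
      1 - δ ≤ (Measure.pi fun _ : Fin N => μ).real A ∧
      ∀ S ∈ A, ∀ i j, j ≠ i → 0 < classProb μ i → S ∉ E i j := by
  set Q := Measure.pi fun _ : Fin N => μ
  let U := ⋃ i ∈ Finset.univ.filter (fun i => 0 < classProb μ i),
    ⋃ j ∈ Finset.univ.erase i, E i j
  have hU : MeasurableSet U :=
    Finset.measurableSet_biUnion _ fun i _ => Finset.measurableSet_biUnion _ fun j _ => hE i j
  have hQU : Q.real U ≤ δ := by
    have hpair : ∀ i ∈ Finset.univ.filter (fun i => 0 < classProb μ i),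
        ∀ j ∈ Finset.univ.erase i, Q.real (E i j) ≤ δ / ((C : ℝ) * ((C : ℝ) - 1)) := by
      intro i hi j hj
      have hij := Finset.ne_of_mem_erase hj
      have hC : (1 : ℝ) < C := by
        have : Nontrivial (Fin C) := ⟨⟨j, i, hij⟩⟩
        have := Fintype.one_lt_card (α := Fin C)
        rw [Fintype.card_fin] at this
        exact_mod_cast this
      refine ENNReal.toReal_le_of_le_ofReal ?_ (hμ i j hij (Finset.mem_filter.1 hi).2)
      have : 0 < (C : ℝ) - 1 := by linarith
      positivity
    rcases Nat.eq_zero_or_pos C with rfl | hC0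
    · have : U = ∅ := by simp [U]
      rw [this]; simpa using hδ.le
    have hC1 : (1 : ℝ) ≤ C := by exact_mod_cast hC0
    have hnn : 0 ≤ δ / ((C : ℝ) * ((C : ℝ) - 1)) := by
      have : 0 ≤ (C : ℝ) - 1 := by linarith
      positivity
    calc Q.real U ≤ ∑ i ∈ Finset.univ.filter (fun i => 0 < classProb μ i),
          ∑ j ∈ Finset.univ.erase i, Q.real (E i j) :=
          (measureReal_biUnion_finset_le _ _).trans
            (Finset.sum_le_sum fun i _ => measureReal_biUnion_finset_le _ _)
      _ ≤ ∑ i ∈ Finset.univ.filter (fun i => 0 < classProb μ i),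
          ∑ j ∈ Finset.univ.erase i, δ / ((C : ℝ) * ((C : ℝ) - 1)) :=
          Finset.sum_le_sum fun i hi => Finset.sum_le_sum fun j hj => hpair i hi j hj
      _ ≤ ∑ i : Fin C, ∑ j ∈ Finset.univ.erase i, δ / ((C : ℝ) * ((C : ℝ) - 1)) :=
          Finset.sum_le_sum_of_subset_of_nonneg (Finset.filter_subset _ _)
            fun i _ _ => Finset.sum_nonneg fun j _ => hnn
      _ = (C : ℝ) * ((C : ℝ) - 1) * (δ / ((C : ℝ) * ((C : ℝ) - 1))) := by
          simp only [Finset.sum_const, Finset.card_erase_of_mem (Finset.mem_univ _),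
            Finset.card_univ, Fintype.card_fin, nsmul_eq_mul]
          push_cast [Nat.cast_sub hC0]
          ring
      _ ≤ δ := by
          -- The product vanishes here only for `C = 1`, when there are no pairs.
          rcases eq_or_ne ((C : ℝ) * ((C : ℝ) - 1)) 0 with h0 | h0
          · rw [h0, zero_mul]; exact hδ.le
          · rw [mul_div_cancel₀ _ h0]
  refine ⟨Uᶜ, hU.compl, ?_, fun S hS i j hij hi hE' => hS ?_⟩
  · rw [probReal_compl_eq_one_sub hU]; linarith
  · simp only [U, Set.mem_iUnion]
    exact ⟨i, Finset.mem_filter.2 ⟨Finset.mem_univ _, hi⟩, j,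
      Finset.mem_erase.2 ⟨hij, Finset.mem_univ _⟩, hE'⟩

/-- Bounds for each pair of classes add up to the multiclass bound. -/
lemma misclassProb_le_of_pairs (μ : Measure (X × Fin C)) [IsProbabilityMeasure μ]
    {f : W → X → EuclideanSpace ℝ (Fin d)} {h : Classifier C d W} (hf : Measurable (f h.2))
    (F : Set (X → ℝ)) (γ : Fin C → Fin C → ℝ) (K δ a : ℝ) (S : Fin N → X × Fin C)
    (hpair : ∀ i j, j ≠ i → 0 < classProb μ i →
      ∃ γ' > 0, ∫ x, ramp γ' (margin f h i j x) ∂(classCond μ i)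
        ≤ a * ((rademacher (classCond μ i) (classCount S i) F).toReal / γ i j)
          + √(Real.log (max 1 (Real.logb 2 (4 * K / γ i j))) / (classCount S i : ℝ))
          + (∑ k ∈ Finset.univ.filter (fun k => (S k).2 = i),
            (if margin f h i j (S k).1 ≤ γ i j then (1 : ℝ) else 0) / (classCount S i : ℝ))
          + √(Real.log ((C : ℝ) * ((C : ℝ) - 1) / δ) / (2 * (classCount S i : ℝ)))) :
    misclassProb μ f h ≤ a * rademacherTerm μ F γ S + logLogTerm μ K γ S
      + empiricalRisk μ f h γ S + confidenceTerm μ δ S := by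
  refine (misclassProb_le μ hf hpair).trans (le_of_eq ?_)
  simp only [rademacherTerm, logLogTerm, empiricalRisk, confidenceTerm, Finset.sum_add_distrib,
    mul_add, Finset.mul_sum]
  simp only [mul_left_comm a]

/-! ### Tail estimates, weights and dyadic levels -/

lemma exp_neg_two_mul_sqrt_sq {n : ℕ} (hn : 0 < n) {L : ℝ} (hL : 1 ≤ L) :
    Real.exp (-2 * n * √(Real.log L / (2 * (n : ℝ))) ^ 2) = 1 / L := by
  have hn' : (0 : ℝ) < n := by exact_mod_cast hn
  have hL0 : 0 < L := by linarith
  rw [Real.sq_sqrt (div_nonneg (Real.log_nonneg hL) (by positivity)),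
    show -2 * (n : ℝ) * (Real.log L / (2 * n)) = -Real.log L by field_simp, Real.exp_neg,
    Real.exp_log hL0, one_div]

/-- The cross term of the square is nonnegative and can be dropped. Dividing `log m` by `n` and not
by `2n` yields `1/m²`, which is summable. -/
lemma exp_neg_two_mul_sqrt_add_sqrt_sq_le {n : ℕ} (hn : 0 < n) {L m : ℝ} (hL : 1 ≤ L)
    (hm : 1 ≤ m) :
    Real.exp (-2 * n * (√(Real.log m / (n : ℝ)) + √(Real.log L / (2 * (n : ℝ)))) ^ 2)
      ≤ 1 / L * (1 / m ^ 2) := by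
  have hn' : (0 : ℝ) < n := by exact_mod_cast hn
  have hm0 : 0 < m := by linarith
  rw [← exp_neg_two_mul_sqrt_sq hn hL]
  have hlog : 1 / m ^ 2 = Real.exp (-2 * n * √(Real.log m / (n : ℝ)) ^ 2) := by
    rw [Real.sq_sqrt (div_nonneg (Real.log_nonneg hm) hn'.le),
      show -2 * (n : ℝ) * (Real.log m / n) = -(2 * Real.log m) by field_simp, Real.exp_neg,
      two_mul, Real.exp_add, Real.exp_log hm0, one_div, sq]
  rw [hlog, ← Real.exp_add]
  refine Real.exp_le_exp.2 ?_
  have := mul_nonneg (mul_nonneg hn'.le (Real.sqrt_nonneg (Real.log m / (n : ℝ))))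
    (Real.sqrt_nonneg (Real.log L / (2 * (n : ℝ))))
  nlinarith

/-- Telescoping with `1/(m+2)² ≤ 1/(m+1) - 1/(m+2)`. Starting at `2` keeps the total mass at most
`1`. -/
lemma sum_range_inv_sq_le (M : ℕ) :
    ∑ m ∈ Finset.range M, 1 / ((m : ℝ) + 2) ^ 2 ≤ 1 - 1 / ((M : ℝ) + 1) := by
  induction M with
  | zero => simp
  | succ M ih =>
    rw [Finset.sum_range_succ]
    have : 1 / ((M : ℝ) + 2) ^ 2 ≤ 1 / ((M : ℝ) + 1) - 1 / ((M : ℝ) + 2) := by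
      rw [div_sub_div _ _ (by positivity) (by positivity), div_le_div_iff₀ (by positivity)
        (by positivity)]
      nlinarith [(Nat.cast_nonneg M : (0 : ℝ) ≤ M)]
    push_cast
    rw [show (M : ℝ) + 1 + 1 = M + 2 by ring]
    linarith

lemma tsum_ofReal_mul_inv_sq_le {c : ℝ} (hc : 0 ≤ c) :
    ∑' m : ℕ, ENNReal.ofReal (c * (1 / ((m : ℝ) + 2) ^ 2)) ≤ ENNReal.ofReal c := by
  refine ENNReal.tsum_le_of_sum_range_le fun M => ?_
  rw [← ENNReal.ofReal_sum_of_nonneg fun m _ => by positivity, ← Finset.mul_sum]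
  refine ENNReal.ofReal_le_ofReal (mul_le_of_le_one_right hc ((sum_range_inv_sq_le M).trans ?_))
  have : 0 ≤ 1 / ((M : ℝ) + 1) := by positivity
  linarith

/-- The dyadic level just below a margin `γ < K`. -/
lemma exists_dyadic_level {K γ : ℝ} (hγ : 0 < γ) (hK : γ < K) :
    ∃ m : ℕ, K / 2 ^ (m + 1) ≤ γ ∧ γ ≤ 2 * (K / 2 ^ (m + 1)) ∧
      (m : ℝ) + 2 ≤ Real.logb 2 (4 * K / γ) := by
  -- Here `2^m ≤ K/γ < 2^(m+1)`; multiplying the left inequality by `4` gives the bound on `m + 2`.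
  obtain ⟨m, h1, h2⟩ := exists_nat_pow_near ((one_le_div hγ).2 hK.le) one_lt_two
  have hK0 : 0 < K := hγ.trans hK
  refine ⟨m, ?_, ?_, ?_⟩
  · rw [div_le_iff₀ (by positivity)]
    rw [div_lt_iff₀ hγ] at h2
    linarith
  · rw [le_div_iff₀ hγ] at h1
    rw [pow_succ, ← div_div, mul_div_cancel₀ _ two_ne_zero, le_div_iff₀ (by positivity)]
    linarith
  · rw [Real.le_logb_iff_rpow_le one_lt_two (by positivity)]
    have : (2 : ℝ) ^ ((m : ℝ) + 2) = 4 * 2 ^ m := by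
      rw [Real.rpow_add two_pos, Real.rpow_natCast]; norm_num; ring
    rw [this, mul_div_assoc]
    linarith

lemma one_le_mul_sub_one_div {δ : ℝ} (hδ : 0 < δ) (hδ1 : δ < 1) {i j : Fin C} (hij : j ≠ i) :
    1 ≤ (C : ℝ) * ((C : ℝ) - 1) / δ := by
  have hC : (2 : ℝ) ≤ C := by
    have : Nontrivial (Fin C) := ⟨⟨j, i, hij⟩⟩
    have := Fintype.one_lt_card (α := Fin C)
    rw [Fintype.card_fin] at this
    exact_mod_cast this
  rw [le_div_iff₀ hδ]
  nlinarith

end Multiclass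

end MulticlassMargin

/-! ### The fixed-margin and the uniform bound -/

open MulticlassMargin in
theorem mainTheorem2 {X W : Type*} [MeasurableSpace X] (C d N : ℕ)
    (μ : Measure (X × Fin C)) [IsProbabilityMeasure μ]
    (f : W → X → EuclideanSpace ℝ (Fin d))
    (H : Set (MulticlassMargin.Classifier C d W))
    (hf : ∀ h ∈ H, Measurable (f h.2))
    (hF : MulticlassMargin.IsPointwiseMeasurable (MulticlassMargin.marginClass f H))
    (K : ℝ)
    (hK : ∀ i : Fin C, ∀ᵐ x ∂(MulticlassMargin.classCond μ i), ∀ h ∈ H, ∀ j : Fin C, j ≠ i →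
      |MulticlassMargin.margin f h i j x| ≤ K)
    (δ : ℝ) (hδ : 0 < δ) :
    (∀ γ : Fin C → Fin C → ℝ, (∀ i j, i ≠ j → 0 < γ i j) →
      ∃ A : Set (Fin N → X × Fin C), MeasurableSet A ∧
        1 - δ ≤ (Measure.pi fun _ : Fin N => μ).real A ∧
        ∀ S ∈ A, MulticlassMargin.Represented μ S → ∀ h ∈ H,
          MulticlassMargin.misclassProb μ f h ≤
            MulticlassMargin.rademacherTerm μ (MulticlassMargin.marginClass f H) γ S
              + MulticlassMargin.logLogTerm μ K γ S
              + MulticlassMargin.empiricalRisk μ f h γ S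
              + MulticlassMargin.confidenceTerm μ δ S) ∧
    (∃ A : Set (Fin N → X × Fin C), MeasurableSet A ∧
      1 - δ ≤ (Measure.pi fun _ : Fin N => μ).real A ∧
      ∀ S ∈ A, MulticlassMargin.Represented μ S → ∀ h ∈ H,
        ∀ γ : Fin C → Fin C → ℝ, (∀ i j, i ≠ j → 0 < γ i j) →
          MulticlassMargin.misclassProb μ f h ≤
            2 * MulticlassMargin.rademacherTerm μ (MulticlassMargin.marginClass f H) γ S
              + MulticlassMargin.logLogTerm μ K γ S
              + MulticlassMargin.empiricalRisk μ f h γ S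
              + MulticlassMargin.confidenceTerm μ δ S) := by
  -- For `δ ≥ 1` the empty event suffices. Otherwise `C(C-1)/δ ≥ 1` whenever a pair exists, so the
  -- logarithm under the root is nonnegative.
  by_cases hδ1 : 1 ≤ δ
  · exact ⟨fun γ _ => ⟨∅, MeasurableSet.empty, by simpa using hδ1, fun S hS => hS.elim⟩,
      ⟨∅, MeasurableSet.empty, by simpa using hδ1, fun S hS => hS.elim⟩⟩
  rw [not_le] at hδ1
  obtain ⟨F₀, hF₀, hc, hlim⟩ := hF
  set F := marginClass f H
  have hm : ∀ g ∈ F₀, Measurable g := by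
    intro g hg
    obtain ⟨h, hh, i, j, -, rfl⟩ := hF₀ hg
    exact measurable_margin (hf h hh) i j
  have hR : ∀ i, 0 < classProb μ i → ∀ n, rademacher (classCond μ i) n F ≠ ⊤ := by
    intro i hi n
    have := isProbabilityMeasure_classCond μ hi
    refine rademacher_ne_top _ n (B := 2 * |K|) ?_
    filter_upwards [hK i] with x hx using abs_le_of_mem_marginClass hx
  have hε : 1 / ((C : ℝ) * ((C : ℝ) - 1) / δ) = δ / ((C : ℝ) * ((C : ℝ) - 1)) := one_div_div _ _
  have hL : ∀ i j : Fin C, j ≠ i → 1 ≤ (C : ℝ) * ((C : ℝ) - 1) / δ := fun i j hij =>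
    one_le_mul_sub_one_div hδ hδ1 hij
  have hmem : ∀ h ∈ H, ∀ i j : Fin C, j ≠ i → margin f h i j ∈ F := fun h hh i j hij =>
    ⟨h, hh, i, j, hij.symm, rfl⟩
  set L := (C : ℝ) * ((C : ℝ) - 1) / δ
  refine ⟨fun γ hγ => ?_, ?_⟩
  · let τ : ℕ → ℝ := fun n => √(Real.log L / (2 * (n : ℝ)))
    obtain ⟨A, hA, hQA, hgood⟩ := exists_measurableSet_forall_notMem (N := N) μ hδ
      (fun i j => marginFailure μ N F F₀ i (γ i j) τ)
      (fun i j => measurableSet_marginFailure μ hc hm i _ τ) fun i j hij hi => by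
        refine measure_marginFailure_le μ hc hm hF₀ hi (hR i hi) (hγ i j hij.symm)
          (fun n => Real.sqrt_nonneg _) fun n hn => ?_
        rw [exp_neg_two_mul_sqrt_sq hn (hL i j hij), hε]
    refine ⟨A, hA, hQA, fun S hS hrep h hh => ?_⟩
    have key := misclassProb_le_of_pairs μ (hf h hh) F γ K δ 1 S fun i j hij hi => by
      refine ⟨γ i j, hγ i j hij.symm, ?_⟩
      have hle := integral_ramp_le_of_notMem_marginFailure μ hm hlim hi (hγ i j hij.symm) le_rfl
        (hgood S hS i j hij hi) (hrep i hi) (hmem h hh i j hij)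
      -- For fixed margins the iterated-logarithm term is not needed; it is only added as a
      -- nonnegative quantity.
      have := Real.sqrt_nonneg
        (Real.log (max 1 (Real.logb 2 (4 * K / γ i j))) / (classCount S i : ℝ))
      simp only [τ] at hle
      linarith
    rwa [one_mul] at key
  · let τ : ℕ → ℕ → ℝ := fun m n =>
      √(Real.log ((m : ℝ) + 2) / (n : ℝ)) + √(Real.log L / (2 * (n : ℝ)))
    -- The null set of samples violating the bound `K`. It need not be measurable, so its measurable
    -- hull is removed.
    let Z : Set (Fin N → X × Fin C) := {S | ¬ ∀ k, ∀ h ∈ H, ∀ j : Fin C, j ≠ (S k).2 →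
      |margin f h (S k).2 j (S k).1| ≤ K}
    have hZ : (Measure.pi fun _ : Fin N => μ) (toMeasurable (Measure.pi fun _ : Fin N => μ) Z)
        = 0 := by
      rw [measure_toMeasurable]
      exact ae_forall_sample μ hK
    obtain ⟨A, hA, hQA, hgood⟩ := exists_measurableSet_forall_notMem (N := N) μ hδ
      (fun i _ => toMeasurable (Measure.pi fun _ : Fin N => μ) Z ∪
        -- The dyadic widths are positive only for `K > 0`; if `K ≤ 0`, every margin falls under the
        -- trivial case `K ≤ γ i j`.
        ⋃ m : ℕ, if 0 < K then marginFailure μ N F F₀ i (K / 2 ^ (m + 1)) (τ m) else ∅)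
      (fun i j => (measurableSet_toMeasurable _ _).union <| MeasurableSet.iUnion fun m => by
        split_ifs
        · exact measurableSet_marginFailure μ hc hm i _ _
        · exact MeasurableSet.empty) fun i j hij hi => by
        refine (measure_union_le _ _).trans ?_
        rw [hZ, zero_add, ← hε]
        have hL0 : 0 ≤ 1 / L := one_div_nonneg.2 (zero_le_one.trans (hL i j hij))
        refine (measure_iUnion_le _).trans ((ENNReal.tsum_le_tsum fun m => ?_).trans
          (tsum_ofReal_mul_inv_sq_le hL0))
        split_ifs with hK0
        · refine measure_marginFailure_le μ hc hm hF₀ hi (hR i hi) (by positivity)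
            (fun n => by positivity) fun n hn => ?_
          exact exp_neg_two_mul_sqrt_add_sqrt_sq_le hn (hL i j hij)
            (by linarith [(Nat.cast_nonneg m : (0 : ℝ) ≤ m)])
        · simp
    refine ⟨A, hA, hQA, fun S hS hrep h hh γ hγ => ?_⟩
    refine misclassProb_le_of_pairs μ (hf h hh) F γ K δ 2 S fun i j hij hi => ?_
    have hS' := hgood S hS i j hij hi
    have hγ0 := hγ i j hij.symm
    have hn := hrep i hi
    have hn' : (0 : ℝ) < classCount S i := by exact_mod_cast hn
    have hprob := isProbabilityMeasure_classCond μ hi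
    have hR0 : 0 ≤ (rademacher (classCond μ i) (classCount S i) F).toReal := ENNReal.toReal_nonneg
    have hs1 := Real.sqrt_nonneg (Real.log L / (2 * (classCount S i : ℝ)))
    rcases le_or_gt K (γ i j) with hKγ | hKγ
    -- The empirical term is `1` here, and the ramp risk is at most `1`.
    · refine ⟨γ i j, hγ0, ?_⟩
      have h1 : ∫ x, ramp (γ i j) (margin f h i j x) ∂(classCond μ i) ≤ 1 :=
        (le_abs_self _).trans (abs_integral_le_of_abs_le fun x => abs_ramp_le_one _ _)
      have hZS : ∀ k, ∀ h ∈ H, ∀ j : Fin C, j ≠ (S k).2 →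
          |margin f h (S k).2 j (S k).1| ≤ K := by
        by_contra hcon
        exact hS' (Or.inl (subset_toMeasurable _ _ hcon))
      have h2 : ∑ k ∈ Finset.univ.filter (fun k => (S k).2 = i),
          (if margin f h i j (S k).1 ≤ γ i j then (1 : ℝ) else 0) / (classCount S i : ℝ) = 1 := by
        have : ∀ k ∈ Finset.univ.filter (fun k => (S k).2 = i),
            (if margin f h i j (S k).1 ≤ γ i j then (1 : ℝ) else 0) / (classCount S i : ℝ)
              = 1 / (classCount S i : ℝ) := by
          intro k hk
          obtain rfl := (Finset.mem_filter.1 hk).2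
          rw [if_pos ((le_abs_self _).trans ((hZS k h hh j hij).trans hKγ))]
        rw [Finset.sum_congr rfl this, Finset.sum_const, nsmul_eq_mul]
        exact mul_one_div_cancel hn'.ne'
      have hs2 := Real.sqrt_nonneg
        (Real.log (max 1 (Real.logb 2 (4 * K / γ i j))) / (classCount S i : ℝ))
      have h3 : 0 ≤ 2 * ((rademacher (classCond μ i) (classCount S i) F).toReal / γ i j) := by
        positivity
      rw [h2]
      linarith
    · have hK0 : 0 < K := hγ0.trans hKγ
      obtain ⟨m, hm1, hm2, hm3⟩ := exists_dyadic_level hγ0 hKγ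
      have hlev : 0 < K / 2 ^ (m + 1) := by positivity
      refine ⟨K / 2 ^ (m + 1), hlev, ?_⟩
      have hSm : S ∉ marginFailure μ N F F₀ i (K / 2 ^ (m + 1)) (τ m) := fun hcon =>
        hS' (Or.inr (Set.mem_iUnion.2 ⟨m, by rwa [if_pos hK0]⟩))
      have hle := integral_ramp_le_of_notMem_marginFailure μ hm hlim hi hlev hm1 hSm hn
        (hmem h hh i j hij)
      -- The factor `2` of the uniform bound: the margin is at most twice its dyadic width.
      have hrad : (rademacher (classCond μ i) (classCount S i) F).toReal / (K / 2 ^ (m + 1))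
          ≤ 2 * ((rademacher (classCond μ i) (classCount S i) F).toReal / γ i j) := by
        rw [← mul_div_assoc, div_le_div_iff₀ hlev hγ0]
        nlinarith
      have hlog : √(Real.log ((m : ℝ) + 2) / (classCount S i : ℝ))
          ≤ √(Real.log (max 1 (Real.logb 2 (4 * K / γ i j))) / (classCount S i : ℝ)) := by
        refine Real.sqrt_le_sqrt (div_le_div_of_nonneg_right ?_ hn'.le)
        exact Real.log_le_log (by positivity) (hm3.trans (le_max_right _ _))
      simp only [τ] at hle
      linarith
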